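/- **Setting.** Let $K$ be an infinite field, $k$ a subfield of $K$, $u=(u_1,\dots,u_m)$ and $X=(x_1,\dots,x_n)$ families of indeterminates, $R=k(u)[X]$, $P$ a prime ideal of $R$ and $S=R_P$. A statement holds *for almost all $\alpha$* if it holds for all $\alpha=(\alpha_1,\dots,\alpha_m)\in K^m$ outside some proper algebraic subvariety of $K^m$. For $\alpha\in K^m$ put $R_\alpha=k(\alpha)[X]$ and let $P_\alpha$ be the ideal of $R_\alpha$ generated by all $f(\alpha,X)$ with $f(u,X)\in P\cap k[u,X]$. Let $S_\alpha=(R_\alpha)_\wp$, where $\wp$ is any associated prime of $P_\alpha$; statements about $S_\alpha$ are meant for all such $\wp$, with an exceptional subvariety that does not depend on $\wp$. For $a\in S$ written as $a=f/g$ with $f,g\in k[u,X]$, $g\notin P$ and $g(\alpha,X)\notin\wp$, put $a_\alpha=f(\alpha,X)/g(\alpha,X)\in S_\alpha$; this does not depend on the choice of such a fraction. For a finitely generated $S$-module $N$ with a finite free presentation $S^{r_1}\xrightarrow{A}S^{r_0}\to N\to 0$, $A=(a_{ij})$, such that all $(a_{ij})_\alpha$ are defined, put $N_\alpha=\operatorname{Coker}\big(S_\alpha^{r_1}\xrightarrow{A_\alpha}S_\alpha^{r_0}\big)$,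 where $A_\alpha=((a_{ij})_\alpha)$. **Proposition 3.3.** Let $L$ and $M$ be finitely generated $S$-modules with given finite free presentations. (a) Let $i\ge 0$ and let finite free presentations of $\mathrm{Ext}^i_S(L,M)$ and $\mathrm{Tor}_i^S(L,M)$ be given. For almost all $\alpha$, the modules $L_\alpha$, $M_\alpha$, $\mathrm{Ext}^i_S(L,M)_\alpha$ and $\mathrm{Tor}_i^S(L,M)_\alpha$ are defined and there are isomorphisms of $S_\alpha$-modules $$\mathrm{Ext}^i_{S_\alpha}(L_\alpha,M_\alpha)\cong \mathrm{Ext}^i_S(L,M)_\alpha,\qquad \mathrm{Tor}_i^{S_\alpha}(L_\alpha,M_\alpha)\cong \mathrm{Tor}_i^S(L,M)_\alpha .$$ (b) For suitable finite free presentations of all the modules $\mathrm{Ext}^i_S(L,M)$ and $\mathrm{Tor}_i^S(L,M)$, $i\ge 0$, the conclusion of (a) holds for almost all $\alpha$ simultaneously for all $i\ge 0$ (one exceptional subvariety serves for all $i$). -/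

import Mathlib

open CategoryTheory MvPolynomial

universe u v

namespace Specialization

/-- A property of `α ∈ K^m` holds *for almost all* `α`: it holds for every `α` outside a proper
algebraic subvariety of `K^m`. Over an infinite field, a subset of `K^m` is contained in a proper
algebraic subvariety if and only if it is contained in a hypersurface `h = 0` with `h ≠ 0`. -/
def AlmostAll (K : Type v) [Field K] (m : ℕ) (Q : (Fin m → K) → Prop) : Prop :=
  ∃ h : MvPolynomial (Fin m) K, h ≠ 0 ∧ ∀ α : Fin m → K, eval α h ≠ 0 → Q α

/-- The ring `k[u, X] = k[u₁, …, u_m][x₁, …, x_n]`. -/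
abbrev PolRing (k : Type u) [Field k] (m n : ℕ) : Type u :=
  MvPolynomial (Fin n) (MvPolynomial (Fin m) k)

/-- The ring `R = k(u)[X]`. -/
abbrev GenRing (k : Type u) [Field k] (m n : ℕ) : Type u :=
  MvPolynomial (Fin n) (FractionRing (MvPolynomial (Fin m) k))

section Rings

variable (k : Type u) {K : Type v} [Field k] [Field K] [Algebra k K] {m : ℕ} (n : ℕ)

/-- The subfield `k(α)` of `K` generated by `α₁, …, α_m` over `k`. -/
def ResField (α : Fin m → K) : Type v := ↥(IntermediateField.adjoin k (Set.range α))

noncomputable instance (α : Fin m → K) : Field (ResField k α) :=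
  inferInstanceAs (Field ↥(IntermediateField.adjoin k (Set.range α)))

noncomputable instance (α : Fin m → K) : Algebra k (ResField k α) :=
  inferInstanceAs (Algebra k ↥(IntermediateField.adjoin k (Set.range α)))

/-- The element `α_i` of `k(α)`. -/
def ResField.gen (α : Fin m → K) (i : Fin m) : ResField k α :=
  (⟨α i, IntermediateField.subset_adjoin k _ ⟨i, rfl⟩⟩ :
    ↥(IntermediateField.adjoin k (Set.range α)))

/-- The ring `R_α = k(α)[X]`. -/
abbrev SpecRing (α : Fin m → K) : Type v :=
  MvPolynomial (Fin n) (ResField k α)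

/-- The substitution `k[u] → k(α)`, `q(u) ↦ q(α)`. -/
noncomputable def substCoeff (α : Fin m → K) : MvPolynomial (Fin m) k →+* ResField k α :=
  (aeval (ResField.gen k α)).toRingHom

/-- The substitution `k[u, X] → R_α`, `f(u, X) ↦ f(α, X)`. -/
noncomputable def subst (α : Fin m → K) : PolRing k m n →+* SpecRing k n α :=
  MvPolynomial.map (substCoeff k α)

/-- The inclusion `k[u, X] ⊆ R = k(u)[X]`. -/
noncomputable def incl (m : ℕ) : PolRing k m n →+* GenRing k m n :=
  MvPolynomial.map (algebraMap _ _)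

variable {k n}

/-- The specialization `I_α` of an ideal `I` of `R`: the ideal of `R_α` generated by the
polynomials `f(α, X)` with `f(u, X) ∈ I ∩ k[u, X]`. -/
noncomputable def specIdeal (α : Fin m → K) (I : Ideal (GenRing k m n)) : Ideal (SpecRing k n α) :=
  (I.comap (incl k n m)).map (subst k n α)

/-- The prime `p` (usually written `℘`) is one of the primes giving a specialization `S_α = (R_α)_℘` of `S = R_P`, that is, an
associated prime of the ideal `P_α`, i.e. of the `R_α`-module `R_α / P_α`. -/
def IsSpecPrime (α : Fin m → K) (P : Ideal (GenRing k m n)) (p : Ideal (SpecRing k n α)) : Prop :=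
  p ∈ associatedPrimes (SpecRing k n α) (SpecRing k n α ⧸ specIdeal α P)

end Rings

section Elements

variable {k : Type u} {K : Type v} [Field k] [Field K] [Algebra k K] {m n : ℕ}
  (P : Ideal (GenRing k m n)) [P.IsPrime] (α : Fin m → K) (p : Ideal (SpecRing k n α)) [p.IsPrime]

/-- `b ∈ S_α` is the specialization of `a ∈ S`: one can write `a = f / g` with `f, g ∈ k[u, X]`,
`g ∉ P`, so that `g(α, X) ∉ p` and `b = f(α, X) / g(α, X)`. (Every element of `S` is such a
fraction, after clearing denominators from `k[u]`.) -/
def IsSpecOf (a : Localization.AtPrime P) (b : Localization.AtPrime p) : Prop :=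
  ∃ f g : PolRing k m n, incl k n m g ∉ P ∧ subst k n α g ∉ p ∧
    a * algebraMap _ _ (incl k n m g) = algebraMap _ _ (incl k n m f) ∧
    b * algebraMap _ _ (subst k n α g) = algebraMap _ _ (subst k n α f)

/-- The specialization of `a` is defined, as an element of `S_α`. -/
def Specializes (a : Localization.AtPrime P) : Prop := ∃ b, IsSpecOf P α p a b

open Classical in
/-- The specialization `a_α ∈ S_α` of `a ∈ S` (with the junk value `0` where it is undefined). -/
noncomputable def specElem (a : Localization.AtPrime P) : Localization.AtPrime p :=
  if h : Specializes P α p a then h.choose else 0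

/-- The specialization of an element is unique wherever it is defined. -/
theorem IsSpecOf.unique {P : Ideal (GenRing k m n)} [P.IsPrime] {α : Fin m → K}
    {p : Ideal (SpecRing k n α)} [p.IsPrime] {a : Localization.AtPrime P}
    {b b' : Localization.AtPrime p} (h : IsSpecOf P α p a b) (h' : IsSpecOf P α p a b') :
    b = b' := by
  obtain ⟨f, g, -, hg, ha, hb⟩ := h
  obtain ⟨f', g', -, hg', ha', hb'⟩ := h'
  have hinj : Function.Injective
      (fun x : PolRing k m n => algebraMap (GenRing k m n) (Localization.AtPrime P) (incl k n m x)) :=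
    (IsLocalization.injective (Localization.AtPrime P)
      P.primeCompl_le_nonZeroDivisors).comp
      (map_injective _ (IsFractionRing.injective (MvPolynomial (Fin m) k) _))
  have key : f * g' = f' * g := by
    apply hinj
    simp only [map_mul]
    rw [← ha, ← ha']
    ring
  have key' := congrArg
    (fun x => algebraMap (SpecRing k n α) (Localization.AtPrime p) (subst k n α x)) key
  simp only [map_mul] at key'
  rw [← hb, ← hb'] at key'
  have u1 := IsLocalization.map_units (Localization.AtPrime p) (⟨_, hg⟩ : p.primeCompl)
  have u2 := IsLocalization.map_units (Localization.AtPrime p) (⟨_, hg'⟩ : p.primeCompl)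
  apply (u1.mul u2).mul_right_cancel
  simp only
  linear_combination key'

theorem IsSpecOf.specElem_eq {P : Ideal (GenRing k m n)} [P.IsPrime] {α : Fin m → K}
    {p : Ideal (SpecRing k n α)} [p.IsPrime] {a : Localization.AtPrime P}
    {b : Localization.AtPrime p} (h : IsSpecOf P α p a b) : specElem P α p a = b := by
  have hs : Specializes P α p a := ⟨b, h⟩
  rw [specElem, dif_pos hs]
  exact hs.choose_spec.unique h

end Elements

/-- A finite free presentation `S^{r₁} → S^{r₀} → M → 0` of an `S`-module `M`, where the map
between the free modules is given by the matrix `mat`. -/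
structure FinFreePres (S : Type u) [CommRing S] (M : Type v) [AddCommGroup M] [Module S M] where
  r₁ : ℕ
  r₀ : ℕ
  mat : Matrix (Fin r₀) (Fin r₁) S
  proj : (Fin r₀ → S) →ₗ[S] M
  exact : Function.Exact mat.mulVecLin proj
  surjective : Function.Surjective proj

/-- Every finitely generated module over a Noetherian ring has a finite free presentation. -/
theorem FinFreePres.nonempty (S : Type u) [CommRing S] [IsNoetherianRing S] (M : Type v)
    [AddCommGroup M] [Module S M] [Module.Finite S M] : Nonempty (FinFreePres S M) := by
  obtain ⟨r₀, f, hf⟩ := Module.Finite.exists_fin' S M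
  obtain ⟨r₁, g, hg⟩ := Module.Finite.exists_fin' S (LinearMap.ker f)
  refine ⟨⟨r₁, r₀, LinearMap.toMatrix' ((LinearMap.ker f).subtype ∘ₗ g), f, ?_, hf⟩⟩
  rw [← Matrix.toLin'_apply', Matrix.toLin'_toMatrix', LinearMap.exact_iff,
    LinearMap.range_comp_of_range_eq_top _ (LinearMap.range_eq_top.2 hg), Submodule.range_subtype]

section Modules

variable {k : Type u} {K : Type v} [Field k] [Field K] [Algebra k K] {m n : ℕ}
  {P : Ideal (GenRing k m n)} [P.IsPrime] {M : Type u} [AddCommGroup M]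
  [Module (Localization.AtPrime P) M] (F : FinFreePres (Localization.AtPrime P) M)
  (α : Fin m → K) (p : Ideal (SpecRing k n α)) [p.IsPrime]

/-- All entries of the matrix `A` of the presentation specialize to elements of `S_α`, so that the
matrix `A_α` and the module `M_α` are defined. -/
def FinFreePres.Specializes : Prop := ∀ i j, Specialization.Specializes P α p (F.mat i j)

/-- The specialization `M_α` of `M` with respect to the given finite free presentation: the
cokernel of the map `S_α^{r₁} → S_α^{r₀}` given by the matrix `A_α = ((a_{ij})_α)`. -/
abbrev FinFreePres.SpecModule : Type v :=
  (Fin F.r₀ → Localization.AtPrime p) ⧸ LinearMap.range (F.mat.map (specElem P α p)).mulVecLin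

end Modules

/-- The `S`-module `Ext^i_S(L, M)`. -/
noncomputable abbrev ExtModule (S : Type u) [CommRing S] (L M : Type u) [AddCommGroup L]
    [Module S L] [AddCommGroup M] [Module S M] (i : ℕ) : ModuleCat.{u} S :=
  ((Ext S (ModuleCat.{u} S) i).obj (Opposite.op (ModuleCat.of S L))).obj (ModuleCat.of S M)

/-- The `S`-module `Tor_i^S(L, M)`. -/
noncomputable abbrev TorModule (S : Type u) [CommRing S] (L M : Type u) [AddCommGroup L]
    [Module S L] [AddCommGroup M] [Module S M] (i : ℕ) : ModuleCat.{u} S :=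
  ((Tor (ModuleCat.{u} S) i).obj (ModuleCat.of S L)).obj (ModuleCat.of S M)

end Specialization

open Specialization

-- The engine is generic flatness. Write A = k[u]. For a finitely generated A[X]-module M there is
-- one nonzero h in A such that Tor₁ over A of M and κ vanishes for every A-module κ on which h acts
-- bijectively. Take M to be the cokernel of a matrix over k[u, X] and κ = k(α) with h(α) ≠ 0: every
-- syzygy of the specialized matrix is then a combination of specialized syzygies
-- (`almostAll_syzygies`).
--
-- This has two consequences. Applied to a row (g, f₁, …, f_s), where the f_j generate P ∩ k[u, X]
-- and g ∉ P, it shows that g(α, X) is a nonzerodivisor modulo P_α. Hence g(α, X) lies in no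
-- associated prime, and denominators survive for all ℘ at once (`generically_subst_notMem`).
-- Applied after clearing denominators, it shows that an exact pair of matrices over S specializes
-- to an exact pair over S_α (`generically_exact`).
--
-- The rest is formal. For almost all α, specialization respects any given finite set of sums,
-- products and exact pairs (`SpecFamily`), so each construction is reduced to finitely many matrix
-- identities and exact pairs. Changes of presentation are of this kind
-- (`SpecFamily.eventually_mod_equiv`), and so are presentations of the homology of a complex of
-- powers of a module (`exists_matHomology_proj`). Ext and Tor are such homology, computed from a
-- free resolution of L and of M respectively.
--
-- Uniformity in i comes from Hilbert's syzygy theorem: modules over S have projective dimension at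
-- most n. Since S is local, L and M have finite resolutions by finite free modules, so only
-- finitely many degrees impose conditions. This gives (b), and (a) follows by changing
-- presentations.

universe w

namespace Specialization

/-! ### Vanishing of Tor₁ without resolutions -/

section TorOneVanish

variable {A : Type u} [CommRing A] {κ : Type v} [AddCommGroup κ] [Module A κ]

variable (A κ) in
/-- The vanishing of `Tor₁(M, κ)`, expressed without resolutions: tensoring with `κ` preserves the
injectivity of the kernel of any surjection onto `M`. -/
def TorOneVanish (M : Type u) [AddCommGroup M] [Module A M] : Prop :=
  ∀ (F : Type u) [AddCommGroup F] [Module A F] (π : F →ₗ[A] M), Function.Surjective π →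
    Function.Injective ((LinearMap.ker π).subtype.rTensor κ)

variable {M M₁ M₂ M₃ : Type u} [AddCommGroup M] [Module A M] [AddCommGroup M₁] [Module A M₁]
  [AddCommGroup M₂] [Module A M₂] [AddCommGroup M₃] [Module A M₃]

theorem TorOneVanish.rTensor_injective (h : TorOneVanish A κ M) {G F : Type u} [AddCommGroup G]
    [Module A G] [AddCommGroup F] [Module A F] {i : G →ₗ[A] F} {π : F →ₗ[A] M}
    (hi : Function.Injective i) (hex : Function.Exact i π) (hπ : Function.Surjective π) :
    Function.Injective (i.rTensor κ) := by
  have hr : LinearMap.ker π = LinearMap.range i := LinearMap.exact_iff.1 hex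
  let e : G ≃ₗ[A] LinearMap.ker π :=
    (LinearEquiv.ofInjective i hi).trans (LinearEquiv.ofEq _ _ hr.symm)
  have he : i = (LinearMap.ker π).subtype ∘ₗ e.toLinearMap := by ext; rfl
  rw [he, LinearMap.rTensor_comp]
  exact (h F π hπ).comp (LinearEquiv.rTensor κ e).injective

theorem TorOneVanish.of_equiv (e : M₁ ≃ₗ[A] M₂) (h : TorOneVanish A κ M₁) :
    TorOneVanish A κ M₂ := fun F _ _ π hπ =>
  h.rTensor_injective (π := e.symm.toLinearMap ∘ₗ π) (Submodule.injective_subtype _)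
    (by rw [LinearMap.exact_iff, LinearEquiv.ker_comp, Submodule.range_subtype])
    (e.symm.surjective.comp hπ)

/-- With N the kernel of F → M₃, the inclusion of ker π factors as ker π ⊆ N ⊆ F. The quotients of
the two steps are M₁ and M₃, so each step stays injective after tensoring. -/
theorem TorOneVanish.of_exact {f : M₁ →ₗ[A] M₂} {g : M₂ →ₗ[A] M₃} (hf : Function.Injective f)
    (hfg : Function.Exact f g) (hg : Function.Surjective g) (h₁ : TorOneVanish A κ M₁)
    (h₃ : TorOneVanish A κ M₃) : TorOneVanish A κ M₂ := by
  intro F _ _ π hπ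
  let N := LinearMap.ker (g ∘ₗ π)
  have hN (x : N) : π x ∈ LinearMap.range f := (hfg _).1 x.2
  let ρ : N →ₗ[A] M₁ := (LinearEquiv.ofInjective f hf).symm.toLinearMap ∘ₗ
    (π ∘ₗ N.subtype).codRestrict (LinearMap.range f) hN
  have hρ (x : N) : f (ρ x) = π x :=
    congrArg Subtype.val ((LinearEquiv.ofInjective f hf).apply_symm_apply ⟨π x, hN x⟩)
  have hle : LinearMap.ker π ≤ N := LinearMap.ker_le_ker_comp π g
  have hs : (LinearMap.ker π).subtype = N.subtype ∘ₗ Submodule.inclusion hle := rfl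
  rw [hs, LinearMap.rTensor_comp]
  refine Function.Injective.comp (g := N.subtype.rTensor κ) (h₃ F (g ∘ₗ π) (hg.comp hπ))
    (h₁.rTensor_injective (π := ρ) (Submodule.inclusion_injective hle) ?_ ?_)
  · rw [LinearMap.exact_iff, Submodule.range_inclusion]
    ext x
    rw [LinearMap.mem_ker, ← hf.eq_iff, hρ, map_zero]
    rfl
  · intro y
    obtain ⟨x, hx⟩ := hπ (f y)
    have hxN : x ∈ N := by
      simp only [N, LinearMap.mem_ker, LinearMap.comp_apply, hx]
      exact hfg.apply_apply_eq_zero y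
    exact ⟨⟨x, hxN⟩, hf (by rw [hρ, hx])⟩

theorem TorOneVanish.of_projective [Module.Projective A M] : TorOneVanish A κ M := by
  intro F _ _ π hπ
  obtain ⟨s, hs⟩ := Module.projective_lifting_property π LinearMap.id hπ
  let r : F →ₗ[A] LinearMap.ker π := (LinearMap.id - s ∘ₗ π).codRestrict _ fun x => by
    have := LinearMap.congr_fun hs (π x)
    rw [LinearMap.mem_ker, LinearMap.sub_apply, map_sub, sub_eq_zero]
    exact this.symm
  have hr : r ∘ₗ (LinearMap.ker π).subtype = LinearMap.id := by
    ext x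
    simp [r]
  have : r.rTensor κ ∘ₗ (LinearMap.ker π).subtype.rTensor κ = LinearMap.id := by
    rw [← LinearMap.rTensor_comp, hr, LinearMap.rTensor_id]
  exact Function.LeftInverse.injective (LinearMap.congr_fun this)

/-- Multiplication by h maps F into ker π, so h on ker π factors through the inclusion into F. After
tensoring, h can be moved to κ, where it is bijective; hence the inclusion is injective. -/
theorem TorOneVanish.of_smul_eq_zero {h : A} (hM : ∀ x : M, h • x = 0)
    (hκ : Function.Bijective fun x : κ => h • x) : TorOneVanish A κ M := by
  intro F _ _ π hπ
  let r : F →ₗ[A] LinearMap.ker π := (LinearMap.lsmul A F h).codRestrict _ fun x => by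
    simp [hM]
  have hr : r ∘ₗ (LinearMap.ker π).subtype = LinearMap.lsmul A _ h := by
    ext x
    rfl
  have hb : Function.Injective ((LinearMap.lsmul A (LinearMap.ker π) h).rTensor κ) := by
    have : (LinearMap.lsmul A (LinearMap.ker π) h).rTensor κ =
        (LinearEquiv.ofBijective (LinearMap.lsmul A κ h) hκ).toLinearMap.lTensor _ := by
      ext x y
      exact TensorProduct.smul_tmul h x y
    rw [this]
    exact (LinearEquiv.lTensor _ (LinearEquiv.ofBijective (LinearMap.lsmul A κ h) hκ)).injective
  rw [← hr, LinearMap.rTensor_comp] at hb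
  exact Function.Injective.of_comp hb

/-- A tensor that dies in F ⊗ κ already dies in Q ⊗ κ for some finitely generated Q. Such a Q is
compact in the lattice of submodules, so it lies in some `G j`, and `G 0` → `G j` is a finite
composite of injective steps. -/
theorem rTensor_injective_of_filtration {F : Type u} [AddCommGroup F] [Module A F]
    (G : ℕ → Submodule A F) (hG : Monotone G) (hsup : ⨆ j, G j = ⊤)
    (hinj : ∀ j, Function.Injective
      ((Submodule.inclusion (hG (Nat.le_succ j))).rTensor κ)) :
    Function.Injective ((G 0).subtype.rTensor κ) := by
  have h0 (j : ℕ) : Function.Injective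
      ((Submodule.inclusion (hG (Nat.zero_le j))).rTensor κ) := by
    induction j with
    | zero =>
      rw [show Submodule.inclusion (hG (Nat.zero_le 0)) = LinearMap.id from rfl,
        LinearMap.rTensor_id]
      exact Function.injective_id
    | succ j ih =>
      rw [show Submodule.inclusion (hG (Nat.zero_le (j + 1))) =
        Submodule.inclusion (hG (Nat.le_succ j)) ∘ₗ Submodule.inclusion (hG (Nat.zero_le j))
        from rfl, LinearMap.rTensor_comp]
      exact (hinj j).comp ih
  rw [injective_iff_map_eq_zero]
  intro t ht
  obtain ⟨P', hP', ht'⟩ := TensorProduct.exists_finite_submodule_left_of_setFinite {t}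
    (Set.finite_singleton t)
  obtain ⟨t', rfl⟩ := ht' (Set.mem_singleton t)
  let P := P'.map (G 0).subtype
  have hP : P.FG := (Module.Finite.iff_fg.1 hP').map _
  let e : P' →ₗ[A] P := ((G 0).subtype ∘ₗ P'.subtype).codRestrict P fun x =>
    Submodule.mem_map_of_mem x.2
  obtain ⟨Q, hPQ, hQ, hz⟩ := TensorProduct.eq_zero_of_fg_of_subtype_eq_zero (t := e.rTensor κ t')
    hP (by
      rw [← LinearMap.rTensor_comp_apply] at ht ⊢
      exact ht)
  obtain ⟨j, hj⟩ : ∃ j, Q ≤ G j := by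
    have hc := (CompleteLattice.isCompactElement_iff_le_of_directed_sSup_le _ Q).1
      ((Submodule.fg_iff_compact Q).1 hQ) (Set.range G) (Set.range_nonempty G)
      hG.directed_le.directedOn_range (by
        change Q ≤ iSup G
        rw [hsup]
        exact le_top)
    obtain ⟨_, ⟨j, rfl⟩, hj⟩ := hc
    exact ⟨j, hj⟩
  apply h0 j
  rw [map_zero, ← LinearMap.rTensor_comp_apply]
  have := congrArg ((Submodule.inclusion hj).rTensor κ) hz
  rw [map_zero, ← LinearMap.rTensor_comp_apply, ← LinearMap.rTensor_comp_apply] at this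
  exact this

/-- The filtration is pulled back to F. It then starts at ker π, and its successive quotients are
those of the filtration of M. -/
theorem TorOneVanish.of_filtration (G : ℕ → Submodule A M) (hG : Monotone G) (h0 : G 0 = ⊥)
    (hsup : ⨆ j, G j = ⊤)
    (h : ∀ j, TorOneVanish A κ (↥(G (j + 1)) ⧸ (G j).submoduleOf (G (j + 1)))) :
    TorOneVanish A κ M := by
  intro F _ _ π hπ
  let G' (j : ℕ) : Submodule A F := (G j).comap π
  have hG' : Monotone G' := fun i j hij => Submodule.comap_mono (hG hij)
  have key := rTensor_injective_of_filtration (κ := κ) G' hG' ?_ ?_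
  · have h0' : G' 0 = LinearMap.ker π := by simp only [G', h0]; rfl
    rwa [h0'] at key
  · rw [eq_top_iff]
    intro x _
    have hx : π x ∈ ⨆ j, G j := hsup ▸ Submodule.mem_top
    rw [Submodule.mem_iSup_of_directed _ hG.directed_le] at hx
    obtain ⟨j, hj⟩ := hx
    exact Submodule.mem_iSup_of_mem j hj
  · intro j
    let π' : G' (j + 1) →ₗ[A] G (j + 1) := π.restrict fun _ hx => hx
    have hπ' : Function.Surjective π' := by
      rintro ⟨y, hy⟩
      obtain ⟨x, rfl⟩ := hπ y
      exact ⟨⟨x, hy⟩, rfl⟩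
    refine (h j).rTensor_injective (π := ((G j).submoduleOf (G (j + 1))).mkQ ∘ₗ π')
      (Submodule.inclusion_injective _) ?_ ((Submodule.mkQ_surjective _).comp hπ')
    rw [LinearMap.exact_iff, LinearMap.ker_comp, Submodule.ker_mkQ, Submodule.range_inclusion]
    rfl

end TorOneVanish

end Specialization

namespace Specialization

/-! ### Generic flatness over a Noetherian domain -/

section GenericVanishing

/-- Generic flatness over `A` of the finitely generated modules over the `A`-algebra `C`: after
inverting some `h ≠ 0` in `A`, there is no `Tor₁`. -/
def GenericTorOneVanish (A C : Type u) [CommRing A] [CommRing C] [Algebra A C] : Prop :=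
  ∀ (M : Type u) [AddCommGroup M] [Module A M] [Module C M] [IsScalarTower A C M]
    [Module.Finite C M], ∃ h : A, h ≠ 0 ∧ ∀ (κ : Type v) [AddCommGroup κ] [Module A κ],
      (Function.Bijective fun x : κ => h • x) → TorOneVanish A κ M

theorem bijective_smul_of_dvd {A : Type u} [CommRing A] {κ : Type v} [AddCommGroup κ] [Module A κ]
    {a b : A} (hab : a ∣ b) (hb : Function.Bijective fun x : κ => b • x) :
    Function.Bijective fun x : κ => a • x := by
  obtain ⟨c, rfl⟩ := hab
  constructor
  · have : (fun x : κ => (a * c) • x) = (fun x => c • x) ∘ fun x => a • x := by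
      ext x
      simp [mul_comm a c, mul_smul]
    exact Function.Injective.of_comp (this ▸ hb.1)
  · have : (fun x : κ => (a * c) • x) = (fun x => a • x) ∘ fun x => c • x := by
      ext x
      simp [mul_smul]
    exact Function.Surjective.of_comp (this ▸ hb.2)

/-- Dévissage to the modules A/p with p prime: for p = 0 the module is free, and otherwise any
nonzero h in p kills it. Extensions multiply the elements to be inverted. -/
theorem genericTorOneVanish_self (A : Type u) [CommRing A] [IsDomain A] [IsNoetherianRing A] :
    GenericTorOneVanish.{u, v} A A := by
  intro M _ iM iM' iT _
  -- There are two `A`-module structures in the hypotheses; the scalar tower over `A` itself forces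
  -- them to agree.
  obtain rfl : iM = iM' := by
    ext a x
    have h : iM'.smul (a * 1) x = iM.smul a (iM'.smul 1 x) := iT.smul_assoc a 1 x
    rw [mul_one, show iM'.smul 1 x = x from iM'.one_smul x] at h
    exact h.symm
  induction ‹Module.Finite A M› using
    IsNoetherianRing.induction_on_isQuotientEquivQuotientPrime A with
  | subsingleton N =>
    exact ⟨1, one_ne_zero, fun κ _ _ hκ => .of_smul_eq_zero (fun x => Subsingleton.elim _ _) hκ⟩
  | quotient N p e =>
    by_cases hp : p.1 = ⊥
    · refine ⟨1, one_ne_zero, fun κ _ _ _ => ?_⟩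
      have : Module.Projective A N :=
        Module.Projective.of_equiv (e.trans (Submodule.quotEquivOfEqBot _ hp)).symm
      exact .of_projective
    · obtain ⟨h, hh, h0⟩ := Submodule.exists_mem_ne_zero_of_ne_bot hp
      refine ⟨h, h0, fun κ _ _ hκ => .of_smul_eq_zero (fun x => e.injective ?_) hκ⟩
      rw [map_smul, map_zero]
      obtain ⟨y, hy⟩ := Ideal.Quotient.mk_surjective (e x)
      rw [← hy, ← Ideal.Quotient.mk_eq_mk, ← Submodule.Quotient.mk_smul]
      exact (Submodule.Quotient.mk_eq_zero _).2 (Ideal.mul_mem_right _ _ hh)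
  | exact N₁ N₂ N₃ f g hf hg hfg ih₁ ih₃ =>
    obtain ⟨a, ha, H₁⟩ := ih₁
    obtain ⟨b, hb, H₃⟩ := ih₃
    refine ⟨a * b, mul_ne_zero ha hb, fun κ _ _ hκ => ?_⟩
    exact .of_exact hf hfg hg (H₁ κ (bijective_smul_of_dvd (dvd_mul_right _ _) hκ))
      (H₃ κ (bijective_smul_of_dvd (dvd_mul_left _ _) hκ))

theorem GenericTorOneVanish.of_algEquiv {A C C' : Type u} [CommRing A] [CommRing C] [Algebra A C]
    [CommRing C'] [Algebra A C'] (e : C ≃ₐ[A] C') (h : GenericTorOneVanish.{u, v} A C) :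
    GenericTorOneVanish.{u, v} A C' := by
  intro M _ _ _ _ _
  let : Module C M := Module.compHom M (e : C →+* C')
  have hsm (c : C) (x : M) : c • x = e c • x := rfl
  have : IsScalarTower A C M := ⟨fun a c x => by rw [hsm, hsm, map_smul, smul_assoc]⟩
  have : Module.Finite C M := by
    obtain ⟨s, hs⟩ := (inferInstance : Module.Finite C' M)
    refine ⟨s, ?_⟩
    rw [eq_top_iff]
    rintro x -
    have hx : x ∈ Submodule.span C' (s : Set M) := hs ▸ Submodule.mem_top
    induction hx using Submodule.span_induction with
    | mem x hx => exact Submodule.subset_span hx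
    | zero => exact zero_mem _
    | add x y _ _ hx hy => exact add_mem hx hy
    | smul a x _ hx =>
      have := Submodule.smul_mem _ (e.symm a) hx
      rwa [hsm, e.apply_symm_apply] at this
  exact h M

/-- The filtration of a module by the sums `∑ i < j, φ^i N`. -/
def powFiltration {C M : Type u} [CommRing C] [AddCommGroup M] [Module C M] (φ : M →ₗ[C] M)
    (N : Submodule C M) : ℕ → Submodule C M
  | 0 => ⊥
  | j + 1 => powFiltration φ N j ⊔ N.map (φ ^ j)

section PowFiltration

variable {C M : Type u} [CommRing C] [AddCommGroup M] [Module C M] (φ : M →ₗ[C] M)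
  (N : Submodule C M)

theorem powFiltration_monotone : Monotone (powFiltration φ N) :=
  monotone_nat_of_le_succ fun _ => le_sup_left

theorem map_powFiltration_le (j : ℕ) :
    (powFiltration φ N j).map φ ≤ powFiltration φ N (j + 1) := by
  induction j with
  | zero => simp [powFiltration]
  | succ j ih =>
    rw [powFiltration, Submodule.map_sup]
    refine sup_le (ih.trans (powFiltration_monotone φ N (Nat.le_succ _))) ?_
    rw [← Submodule.map_comp, ← Module.End.mul_eq_comp, ← pow_succ']
    exact le_sup_right

/-- The map `φ^j` from `N` to the `j`-th quotient of the filtration. -/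
def powFiltrationMap (j : ℕ) : N →ₗ[C] ↥(powFiltration φ N (j + 1)) ⧸
    (powFiltration φ N j).submoduleOf (powFiltration φ N (j + 1)) :=
  Submodule.mkQ _ ∘ₗ ((φ ^ j) ∘ₗ N.subtype).codRestrict _ fun x =>
    Submodule.mem_sup_right (Submodule.mem_map_of_mem x.2)

theorem powFiltrationMap_surjective (j : ℕ) : Function.Surjective (powFiltrationMap φ N j) := by
  intro y
  obtain ⟨⟨y, hy⟩, rfl⟩ := Submodule.mkQ_surjective _ y
  obtain ⟨a, ha, _, ⟨x, hx, rfl⟩, rfl⟩ := Submodule.mem_sup.1 hy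
  refine ⟨⟨x, hx⟩, ?_⟩
  refine (Submodule.Quotient.eq _).2 ?_
  change (φ ^ j) x - (a + (φ ^ j) x) ∈ powFiltration φ N j
  simpa using ha

theorem ker_powFiltrationMap (j : ℕ) : LinearMap.ker (powFiltrationMap φ N j) =
    (powFiltration φ N j).comap ((φ ^ j) ∘ₗ N.subtype) := by
  rw [powFiltrationMap, LinearMap.ker_comp, Submodule.ker_mkQ]
  rfl

/-- The kernel consists of the x in N with φ^j x in the j-th step, and φ carries the j-th step into
the next one. -/
theorem ker_powFiltrationMap_monotone : Monotone fun j => LinearMap.ker (powFiltrationMap φ N j) := by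
  refine monotone_nat_of_le_succ fun j x hx => ?_
  rw [ker_powFiltrationMap] at hx ⊢
  have := map_powFiltration_le φ N j (Submodule.mem_map_of_mem hx)
  simpa [pow_succ'] using this

end PowFiltration

/-- Let N be the C-span of finitely many generators of M, and filter M by the sums of X^i N. The
successive quotients are quotients of N by an increasing chain of kernels. As N is Noetherian the
chain stabilizes, so only finitely many quotients occur up to isomorphism, and a product of finitely
many elements of A serves for all of them. -/
theorem GenericTorOneVanish.polynomial {A C : Type u} [CommRing A] [IsDomain A] [CommRing C]
    [IsNoetherianRing C] [Algebra A C] (hC : GenericTorOneVanish.{u, v} A C) :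
    GenericTorOneVanish.{u, v} A (Polynomial C) := by
  intro M _ _ _ _ _
  let : Module C M := Module.compHom M (Polynomial.C : C →+* Polynomial C)
  have hsm (c : C) (x : M) : c • x = Polynomial.C c • x := rfl
  have : IsScalarTower C (Polynomial C) M :=
    ⟨fun c p x => by rw [hsm, ← mul_smul, Polynomial.smul_eq_C_mul]⟩
  have : IsScalarTower A C M := ⟨fun a c x => by
    rw [hsm, hsm, ← smul_assoc, Polynomial.smul_C]⟩
  let φ : M →ₗ[C] M := LinearMap.lsmul (Polynomial C) M Polynomial.X |>.restrictScalars C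
  obtain ⟨s, hs⟩ := (inferInstance : Module.Finite (Polynomial C) M)
  let N : Submodule C M := Submodule.span C (s : Set M)
  have : Module.Finite C N := Module.Finite.span_finset C s
  have hsup : ⨆ j, powFiltration φ N j = ⊤ := by
    rw [eq_top_iff]
    rintro x -
    have hdir := (powFiltration_monotone φ N).directed_le
    have hX (y : M) (hy : y ∈ ⨆ j, powFiltration φ N j) :
        (Polynomial.X : Polynomial C) • y ∈ ⨆ j, powFiltration φ N j := by
      obtain ⟨j, hj⟩ := (Submodule.mem_iSup_of_directed _ hdir).1 hy
      exact Submodule.mem_iSup_of_mem (j + 1)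
        (map_powFiltration_le φ N j (Submodule.mem_map_of_mem (f := φ) hj))
    have hx : x ∈ Submodule.span (Polynomial C) (s : Set M) := hs ▸ Submodule.mem_top
    induction hx using Submodule.span_induction with
    | mem x hx =>
      refine Submodule.mem_iSup_of_mem 1 (Submodule.mem_sup_right ?_)
      exact ⟨x, Submodule.subset_span hx, by simp⟩
    | zero => exact zero_mem _
    | add x y _ _ hx hy => exact add_mem hx hy
    | smul a x _ hx =>
      induction a using Polynomial.induction_on' with
      | add p q hp hq => rw [add_smul]; exact add_mem hp hq
      | monomial n c =>
        rw [← Polynomial.C_mul_X_pow_eq_monomial, mul_smul, ← hsm]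
        refine Submodule.smul_mem _ _ ?_
        induction n with
        | zero => simpa using hx
        | succ n ih => rw [pow_succ', mul_smul]; exact hX _ ih
  choose h h0 H using fun j => hC (N ⧸ LinearMap.ker (powFiltrationMap φ N j))
  obtain ⟨n, hn⟩ := monotone_stabilizes_iff_noetherian.2 (inferInstance : IsNoetherian C N)
    ⟨_, ker_powFiltrationMap_monotone φ N⟩
  refine ⟨∏ j ∈ Finset.range (n + 1), h j, Finset.prod_ne_zero_iff.2 fun j _ => h0 j,
    fun κ _ _ hκ => ?_⟩
  refine .of_filtration (fun j => (powFiltration φ N j).restrictScalars A)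
    (powFiltration_monotone φ N) rfl ?_ fun j => ?_
  · rw [← Submodule.restrictScalars_top (R := C), ← hsup]
    exact (map_iSup (Submodule.restrictScalarsLatticeHom A C M) _).symm
  · have hj : ∃ i ≤ n, LinearMap.ker (powFiltrationMap φ N i) =
        LinearMap.ker (powFiltrationMap φ N j) := by
      rcases le_total j n with hjn | hjn
      · exact ⟨j, hjn, rfl⟩
      · exact ⟨n, le_rfl, hn j hjn⟩
    obtain ⟨i, hi, hij⟩ := hj
    have := H i κ (bijective_smul_of_dvd
      (Finset.dvd_prod_of_mem h (Finset.mem_range.2 (Nat.lt_succ_of_le hi))) hκ)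
    refine this.of_equiv ?_
    exact ((Submodule.quotEquivOfEq _ _ hij).trans
      ((powFiltrationMap φ N j).quotKerEquivOfSurjective
        (powFiltrationMap_surjective φ N j))).restrictScalars A

theorem genericTorOneVanish_mvPolynomial (A : Type u) [CommRing A] [IsDomain A]
    [IsNoetherianRing A] (n : ℕ) :
    GenericTorOneVanish.{u, v} A (MvPolynomial (Fin n) A) := by
  induction n with
  | zero => exact (genericTorOneVanish_self A).of_algEquiv (isEmptyAlgEquiv A (Fin 0)).symm
  | succ n ih => exact ih.polynomial.of_algEquiv (finSuccEquiv A n).symm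

end GenericVanishing

end Specialization

namespace Specialization

/-! ### Syzygies under base change of the coefficients -/

section Syzygies

theorem isBaseChange_pi_map {A : Type u} [CommRing A] {κ : Type v} [CommRing κ] [Algebra A κ]
    (n : ℕ) (ι : Type) [Finite ι] :
    IsBaseChange κ ((mapAlgHom (σ := Fin n) (Algebra.ofId A κ)).toLinearMap.compLeft ι) := by
  have h : IsBaseChange κ (mapAlgHom (σ := Fin n) (Algebra.ofId A κ)).toLinearMap :=
    IsBaseChange.of_equiv (algebraTensorAlgEquiv (σ := Fin n) A κ).toLinearEquiv fun x => by
      refine (algebraTensorAlgEquiv_tmul A κ (1 : κ) x).trans ?_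
      rw [one_smul]
      rfl
  exact IsBaseChange.finitePow ι h

/-- Factor D through its image I. Tor₁-vanishing for the cokernel keeps I → A[X]^ι injective after
tensoring with κ, and right exactness identifies the kernel of the tensored surjection onto I with
the image of κ ⊗ ker D. So the kernel over κ is spanned by images of syzygies over A. -/
theorem mem_span_of_torOneVanish {A : Type u} [CommRing A] {κ : Type v} [CommRing κ] [Algebra A κ]
    {n : ℕ} {ι ι' : Type} [Fintype ι] [Fintype ι'] (D : Matrix ι ι' (MvPolynomial (Fin n) A))
    (h : TorOneVanish A κ ((ι → MvPolynomial (Fin n) A) ⧸ LinearMap.range D.mulVecLin))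
    (y : ι' → MvPolynomial (Fin n) κ)
    (hy : (D.map (MvPolynomial.map (algebraMap A κ))).mulVec y = 0) :
    y ∈ Submodule.span (MvPolynomial (Fin n) κ)
      {w | ∃ v, D.mulVec v = 0 ∧ w = fun j => MvPolynomial.map (algebraMap A κ) (v j)} := by
  let T := MvPolynomial (Fin n) κ
  let I := LinearMap.range D.mulVecLin
  let N := LinearMap.ker D.mulVecLin
  let s : I →ₗ[A] (ι → MvPolynomial (Fin n) A) := I.subtype.restrictScalars A
  let d : (ι' → MvPolynomial (Fin n) A) →ₗ[A] I := D.mulVecLin.rangeRestrict.restrictScalars A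
  let j : N →ₗ[A] (ι' → MvPolynomial (Fin n) A) := N.subtype.restrictScalars A
  have hs : Function.Injective (s.lTensor κ) := by
    rw [LinearMap.lTensor_inj_iff_rTensor_inj]
    refine h.rTensor_injective (π := I.mkQ.restrictScalars A) I.injective_subtype ?_
      I.mkQ_surjective
    exact LinearMap.exact_subtype_mkQ I
  have hd : Function.Exact (j.lTensor κ) (d.lTensor κ) := by
    refine lTensor_exact κ ?_ D.mulVecLin.surjective_rangeRestrict
    intro x
    simp [d, j, N, Subtype.ext_iff]
  have e := isBaseChange_pi_map (A := A) (κ := κ) n ι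
  have e' := isBaseChange_pi_map (A := A) (κ := κ) n ι'
  obtain ⟨t, rfl⟩ := e'.equiv.surjective y
  have hcomm (t) : e.equiv ((s ∘ₗ d).lTensor κ t) =
      (D.map (MvPolynomial.map (algebraMap A κ))).mulVec (e'.equiv t) := by
    induction t with
    | zero => simp
    | add x y hx hy => simp only [map_add, hx, hy, Matrix.mulVec_add]
    | tmul c x =>
      rw [LinearMap.lTensor_tmul, IsBaseChange.equiv_tmul, IsBaseChange.equiv_tmul,
        Matrix.mulVec_smul]
      congr 1
      ext1 i
      exact RingHom.map_mulVec (MvPolynomial.map (algebraMap A κ)) D x i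
  rw [← hcomm, EmbeddingLike.map_eq_zero_iff, LinearMap.lTensor_comp, LinearMap.comp_apply,
    map_eq_zero_iff _ hs] at hy
  obtain ⟨z, rfl⟩ := (hd t).1 hy
  clear hy
  induction z with
  | zero => simp
  | add x y hx hy => simp only [map_add]; exact add_mem hx hy
  | tmul c x =>
    rw [LinearMap.lTensor_tmul, IsBaseChange.equiv_tmul, ← algebraMap_smul T c]
    exact Submodule.smul_mem _ _ (Submodule.subset_span ⟨x, x.2, rfl⟩)

end Syzygies

/-! ### Almost all points, and specialization of syzygies -/

section AlmostAll

variable {K : Type v} [Field K] {m : ℕ}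

theorem AlmostAll.mono {Q Q' : (Fin m → K) → Prop} (h : AlmostAll K m Q) (hQ : ∀ α, Q α → Q' α) :
    AlmostAll K m Q' := by
  obtain ⟨f, hf, H⟩ := h
  exact ⟨f, hf, fun α hα => hQ α (H α hα)⟩

theorem AlmostAll.of_forall {Q : (Fin m → K) → Prop} (h : ∀ α, Q α) : AlmostAll K m Q :=
  ⟨1, one_ne_zero, fun α _ => h α⟩

theorem AlmostAll.and {Q Q' : (Fin m → K) → Prop} (h : AlmostAll K m Q) (h' : AlmostAll K m Q') :
    AlmostAll K m fun α => Q α ∧ Q' α := by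
  obtain ⟨f, hf, H⟩ := h
  obtain ⟨g, hg, H'⟩ := h'
  refine ⟨f * g, mul_ne_zero hf hg, fun α hα => ?_⟩
  rw [map_mul] at hα
  exact ⟨H α (left_ne_zero_of_mul hα), H' α (right_ne_zero_of_mul hα)⟩

theorem AlmostAll.forall_finite {ι : Type*} [Finite ι] {Q : ι → (Fin m → K) → Prop}
    (h : ∀ i, AlmostAll K m (Q i)) : AlmostAll K m fun α => ∀ i, Q i α := by
  have := Fintype.ofFinite ι
  choose f hf H using h
  refine ⟨∏ i, f i, Finset.prod_ne_zero_iff.2 fun i _ => hf i, fun α hα i => H i α ?_⟩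
  rw [map_prod] at hα
  exact Finset.prod_ne_zero_iff.1 hα i (Finset.mem_univ i)

variable {k : Type u} [Field k] [Algebra k K]

/-- The exceptional hypersurface is h itself with coefficients read in K; as k(α) is a subfield of
K, the value h(α) can be computed there. -/
theorem almostAll_substCoeff_ne_zero {h : MvPolynomial (Fin m) k} (hh : h ≠ 0) :
    AlmostAll K m fun α => substCoeff k α h ≠ 0 := by
  refine ⟨MvPolynomial.map (algebraMap k K) h, ?_, fun α hα h0 => hα ?_⟩
  · rwa [Ne, map_eq_zero_iff _ (map_injective _ (algebraMap k K).injective)]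
  · let ι : ResField k α →ₐ[k] K := (IntermediateField.adjoin k (Set.range α)).val
    have : aeval α h = ι (substCoeff k α h) := by
      have : aeval α = ι.comp (aeval (ResField.gen k α)) := by
        ext i
        simp
        rfl
      rw [this]
      rfl
    rw [MvPolynomial.eval_map, ← aeval_def, this, h0, map_zero]

/-- For almost all `α`, the syzygies of a specialized matrix are generated by specialized
syzygies. -/
theorem almostAll_syzygies {n : ℕ} {ι ι' : Type} [Fintype ι] [Fintype ι']
    (D : Matrix ι ι' (PolRing k m n)) :
    AlmostAll K m fun α => ∀ y, (D.map (subst k n α)).mulVec y = 0 →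
      y ∈ Submodule.span (SpecRing k n α)
        {w | ∃ v, D.mulVec v = 0 ∧ w = fun j => subst k n α (v j)} := by
  obtain ⟨h, h0, H⟩ := genericTorOneVanish_mvPolynomial.{u, v} (MvPolynomial (Fin m) k) n
    ((ι → PolRing k m n) ⧸ LinearMap.range D.mulVecLin)
  refine (almostAll_substCoeff_ne_zero h0).mono fun α hα y hy => ?_
  let : Algebra (MvPolynomial (Fin m) k) (ResField k α) := (substCoeff k α).toAlgebra
  -- On the field k(α), h acts as multiplication by h(α) ≠ 0, which is bijective.
  refine mem_span_of_torOneVanish D (H (ResField k α) ?_) y hy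
  have : (fun x : ResField k α => h • x) = fun x => substCoeff k α h * x := by
    ext x
    rw [Algebra.smul_def]
    rfl
  rw [this]
  exact mulLeft_bijective₀ _ hα

end AlmostAll

end Specialization

namespace Specialization

/-! ### Clearing denominators from S to k[u, X] -/

section Fractions

variable {k : Type u} [Field k] {m n : ℕ} (P : Ideal (GenRing k m n)) [P.IsPrime]

/-- The map `k[u, X] → S`. -/
noncomputable def polToLoc : PolRing k m n →+* Localization.AtPrime P :=
  (algebraMap _ _).comp (incl k n m)

theorem incl_injective : Function.Injective (incl k n m) :=
  map_injective _ (IsFractionRing.injective (MvPolynomial (Fin m) k) _)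

theorem polToLoc_injective : Function.Injective (polToLoc P) :=
  (IsLocalization.injective (Localization.AtPrime P)
    P.primeCompl_le_nonZeroDivisors).comp incl_injective

theorem isUnit_polToLoc {g : PolRing k m n} (hg : incl k n m g ∉ P) : IsUnit (polToLoc P g) :=
  IsLocalization.map_units (Localization.AtPrime P) (⟨_, hg⟩ : P.primeCompl)

theorem incl_prod_notMem {ι : Type*} (s : Finset ι) {g : ι → PolRing k m n}
    (hg : ∀ i ∈ s, incl k n m (g i) ∉ P) : incl k n m (∏ i ∈ s, g i) ∉ P := by
  rw [map_prod]
  exact fun h => let ⟨i, hi, hi'⟩ := (Ideal.IsPrime.prod_mem_iff).1 h; hg i hi hi'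

theorem incl_mul_notMem {g g' : PolRing k m n} (hg : incl k n m g ∉ P) (hg' : incl k n m g' ∉ P) :
    incl k n m (g * g') ∉ P := by
  rw [map_mul]
  exact fun h => (‹P.IsPrime›.mem_or_mem h).elim hg hg'

theorem exists_mul_incl_eq (r : GenRing k m n) :
    ∃ f d : PolRing k m n, IsUnit (incl k n m d) ∧ r * incl k n m d = incl k n m f := by
  let := algebraMvPolynomial (σ := Fin n) (R := MvPolynomial (Fin m) k)
    (S := FractionRing (MvPolynomial (Fin m) k))
  obtain ⟨⟨f, d⟩, hd⟩ := IsLocalization.surj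
    ((nonZeroDivisors (MvPolynomial (Fin m) k)).map (C : _ →+* PolRing k m n)) r
  refine ⟨f, d, ?_, hd⟩
  exact IsLocalization.map_units (GenRing k m n) d

theorem exists_mul_polToLoc_eq (a : Localization.AtPrime P) :
    ∃ f g : PolRing k m n, incl k n m g ∉ P ∧ a * polToLoc P g = polToLoc P f := by
  obtain ⟨⟨r, s⟩, hrs⟩ := IsLocalization.surj P.primeCompl a
  obtain ⟨f, d, hd, hf⟩ := exists_mul_incl_eq r
  obtain ⟨f', d', hd', hf'⟩ := exists_mul_incl_eq (s : GenRing k m n)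
  have hu {x : GenRing k m n} (hx : IsUnit x) : x ∉ P := fun h =>
    ‹P.IsPrime›.ne_top (Ideal.eq_top_of_isUnit_mem P h hx)
  refine ⟨f * d', f' * d, ?_, ?_⟩
  · rw [map_mul, ← hf']
    exact fun h => (‹P.IsPrime›.mem_or_mem h).elim
      (fun h => (‹P.IsPrime›.mem_or_mem h).elim s.2 (hu hd')) (hu hd)
  · simp only [polToLoc, RingHom.comp_apply, map_mul, ← hf, ← hf']
    rw [← hrs]
    ring

theorem exists_common_denominator {ι : Type*} [Finite ι] (a : ι → Localization.AtPrime P) :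
    ∃ (f : ι → PolRing k m n) (g : PolRing k m n), incl k n m g ∉ P ∧
      ∀ i, a i * polToLoc P g = polToLoc P (f i) := by
  have := Fintype.ofFinite ι
  choose f g hg H using fun i => exists_mul_polToLoc_eq P (a i)
  choose c hc using fun i => Finset.dvd_prod_of_mem g (Finset.mem_univ i)
  refine ⟨fun i => f i * c i, ∏ i, g i, incl_prod_notMem P _ fun i _ => hg i, fun i => ?_⟩
  rw [hc i, map_mul, map_mul, ← mul_assoc, H]

end Fractions

/-! ### Associated primes of P_α avoid specialized denominators -/

section Generically

variable {k : Type u} {K : Type v} [Field k] [Field K] [Algebra k K] {m n : ℕ}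

/-- A property of `S_α = (R_α)_p` holds for almost all `α` and all associated primes `p`
of `P_α`. -/
def Generically (K : Type v) [Field K] [Algebra k K] (P : Ideal (GenRing k m n))
    (Q : ∀ (α : Fin m → K) (p : Ideal (SpecRing k n α)) [p.IsPrime], Prop) : Prop :=
  AlmostAll K m fun α => ∀ (p : Ideal (SpecRing k n α)) [p.IsPrime], IsSpecPrime α P p → Q α p

variable {P : Ideal (GenRing k m n)}
  {Q Q' : ∀ (α : Fin m → K) (p : Ideal (SpecRing k n α)) [p.IsPrime], Prop}

theorem Generically.mono (h : Generically K P Q)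
    (hQ : ∀ (α : Fin m → K) (p : Ideal (SpecRing k n α)) [p.IsPrime], Q α p → Q' α p) :
    Generically K P Q' :=
  AlmostAll.mono h fun _ H p _ hp => hQ _ p (H p hp)

theorem Generically.and (h : Generically K P Q) (h' : Generically K P Q') :
    Generically K P fun α p _ => Q α p ∧ Q' α p :=
  AlmostAll.mono (AlmostAll.and h h') fun _ H p _ hp => ⟨H.1 p hp, H.2 p hp⟩

theorem Generically.of_almostAll {Q : (Fin m → K) → Prop} (h : AlmostAll K m Q) :
    Generically K P fun α _ _ => Q α :=
  h.mono fun _ H _ _ _ => H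

theorem Generically.forall_finite {ι : Type*} [Finite ι]
    {Q : ι → ∀ (α : Fin m → K) (p : Ideal (SpecRing k n α)) [p.IsPrime], Prop}
    (h : ∀ i, Generically K P (Q i)) : Generically K P fun α p _ => ∀ i, Q i α p :=
  AlmostAll.mono (AlmostAll.forall_finite h) fun _ H p _ hp i => H i p hp

/-- Since g ∉ P, every syzygy of (g, f₁, …, f_s) has its first entry in P ∩ k[u, X]. The syzygies of
the specialized row are combinations of specialized ones, so their first entries lie in P_α. If p is
the annihilator of the class of x and contained g(α, X), then x would be such a first entry, hence
zero modulo P_α. -/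
theorem generically_subst_notMem [P.IsPrime] {g : PolRing k m n} (hg : incl k n m g ∉ P) :
    Generically K P fun α p _ => subst k n α g ∉ p := by
  obtain ⟨s, f, hf⟩ := Submodule.fg_iff_exists_fin_generating_family.1
    (IsNoetherian.noetherian (P.comap (incl k n m)))
  let D : Matrix Unit (Option (Fin s)) (PolRing k m n) := Matrix.of fun _ j => j.elim g f
  refine (almostAll_syzygies D).mono fun α H p _ hp hgp => ?_
  obtain ⟨-, x, hx⟩ := isAssociatedPrime_iff.1 hp
  obtain ⟨x, rfl⟩ := Ideal.Quotient.mk_surjective x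
  have hmem (r : SpecRing k n α) : r ∈ p ↔ r * x ∈ specIdeal α P := by
    rw [hx, Submodule.mem_colon_singleton, Submodule.mem_bot, ← Ideal.Quotient.eq_zero_iff_mem]
    rfl
  have hspec : specIdeal α P = Ideal.span (Set.range fun j => subst k n α (f j)) := by
    have : P.comap (incl k n m) = Ideal.span (Set.range f) := hf.symm
    rw [specIdeal, this, Ideal.map_span, ← Set.range_comp]
    rfl
  have hx1 : x ∉ specIdeal α P := fun h =>
    ‹p.IsPrime›.ne_top ((Ideal.eq_top_iff_one p).2 ((hmem 1).2 (by rwa [one_mul])))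
  have hgx := (hmem _).1 hgp
  rw [hspec] at hgx
  obtain ⟨c, hc⟩ := (Submodule.mem_span_range_iff_exists_fun _).1 hgx
  -- The relation g(α, X) x = ∑ c_j f_j(α, X), read as a syzygy with first entry x.
  let y : Option (Fin s) → SpecRing k n α := fun j => j.elim x fun j => - c j
  have hy := H y (by
    ext1 i
    simp only [Matrix.mulVec, dotProduct, Fintype.sum_option, Matrix.map_apply, D, y,
      Option.elim_none, Option.elim_some, Pi.zero_apply, Matrix.of_apply, ← hc]
    simp [mul_comm])
  have hle : Submodule.span (SpecRing k n α)
      {w | ∃ v, D.mulVec v = 0 ∧ w = fun j => subst k n α (v j)} ≤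
      Submodule.comap (LinearMap.proj (R := SpecRing k n α)
        (φ := fun _ : Option (Fin s) => SpecRing k n α) none) (specIdeal α P) := by
    rw [Submodule.span_le]
    rintro _ ⟨v, hv, rfl⟩
    refine Ideal.mem_map_of_mem _ ?_
    have hv' := congrFun hv ()
    simp only [Matrix.mulVec, dotProduct, Fintype.sum_option, D,
      Matrix.of_apply, Option.elim_none, Option.elim_some, Pi.zero_apply] at hv'
    have hfj (j : Fin s) : f j ∈ P.comap (incl k n m) := hf ▸ Submodule.subset_span ⟨j, rfl⟩
    have hgv : g * v none ∈ P.comap (incl k n m) := by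
      rw [eq_neg_of_add_eq_zero_left hv']
      exact neg_mem (sum_mem fun j _ => Ideal.mul_mem_right _ _ (hfj j))
    exact ((inferInstance : (P.comap (incl k n m)).IsPrime).mem_or_mem hgv).resolve_left hg
  exact hx1 (hle hy)

end Generically

/-! ### Specialization of elements of S -/

section SpecElem

variable {k : Type u} {K : Type v} [Field k] [Field K] [Algebra k K] {m n : ℕ}
  {P : Ideal (GenRing k m n)} [P.IsPrime] {α : Fin m → K} {p : Ideal (SpecRing k n α)} [p.IsPrime]

variable (α p) in
/-- The map `k[u, X] → S_α`. -/
noncomputable def polToSpec : PolRing k m n →+* Localization.AtPrime p :=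
  (algebraMap _ _).comp (subst k n α)

theorem isUnit_polToSpec {g : PolRing k m n} (hg : subst k n α g ∉ p) :
    IsUnit (polToSpec α p g) :=
  IsLocalization.map_units (Localization.AtPrime p) (⟨_, hg⟩ : p.primeCompl)

theorem isSpecOf_of_eq {a : Localization.AtPrime P} {f g : PolRing k m n}
    (hg : incl k n m g ∉ P) (hg' : subst k n α g ∉ p)
    (h : a * polToLoc P g = polToLoc P f) :
    ∃ b, IsSpecOf P α p a b ∧ b * polToSpec α p g = polToSpec α p f := by
  obtain ⟨c, hc⟩ := (isUnit_polToSpec hg').exists_left_inv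
  have hb : polToSpec α p f * c * polToSpec α p g = polToSpec α p f := by
    rw [mul_assoc, hc, mul_one]
  exact ⟨polToSpec α p f * c, ⟨f, g, hg, hg', h, hb⟩, hb⟩

theorem Specializes.isSpecOf {a : Localization.AtPrime P} (h : Specializes P α p a) :
    IsSpecOf P α p a (specElem P α p a) := by
  obtain ⟨b, hb⟩ := h
  rwa [hb.specElem_eq]

theorem isSpecOf_zero : IsSpecOf P α p 0 0 :=
  ⟨0, 1, by rw [map_one]; exact P.primeCompl.one_mem, by rw [map_one]; exact p.primeCompl.one_mem,
    by simp, by simp⟩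

theorem isSpecOf_one : IsSpecOf P α p 1 1 :=
  ⟨1, 1, by rw [map_one]; exact P.primeCompl.one_mem, by rw [map_one]; exact p.primeCompl.one_mem,
    by simp, by simp⟩

theorem IsSpecOf.add {a a' : Localization.AtPrime P} {b b' : Localization.AtPrime p}
    (h : IsSpecOf P α p a b) (h' : IsSpecOf P α p a' b') :
    IsSpecOf P α p (a + a') (b + b') := by
  obtain ⟨f, g, h1, h2, h3, h4⟩ := h
  obtain ⟨f', g', h1', h2', h3', h4'⟩ := h'
  refine ⟨f * g' + f' * g, g * g', ?_, ?_, ?_, ?_⟩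
  · exact incl_mul_notMem P h1 h1'
  · rw [map_mul]; exact p.primeCompl.mul_mem h2 h2'
  · simp only [map_mul, map_add, ← h3, ← h3']; ring
  · simp only [map_mul, map_add, ← h4, ← h4']; ring

theorem IsSpecOf.mul {a a' : Localization.AtPrime P} {b b' : Localization.AtPrime p}
    (h : IsSpecOf P α p a b) (h' : IsSpecOf P α p a' b') :
    IsSpecOf P α p (a * a') (b * b') := by
  obtain ⟨f, g, h1, h2, h3, h4⟩ := h
  obtain ⟨f', g', h1', h2', h3', h4'⟩ := h'
  refine ⟨f * f', g * g', ?_, ?_, ?_, ?_⟩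
  · exact incl_mul_notMem P h1 h1'
  · rw [map_mul]; exact p.primeCompl.mul_mem h2 h2'
  · simp only [map_mul, ← h3, ← h3']; ring
  · simp only [map_mul, ← h4, ← h4']; ring

@[simp]
theorem specElem_zero : specElem P α p 0 = 0 := isSpecOf_zero.specElem_eq

@[simp]
theorem specElem_one : specElem P α p 1 = 1 := isSpecOf_one.specElem_eq

end SpecElem

/-! ### Specialization of matrices and of exactness -/

section SpecMatrix

variable {k : Type u} {K : Type v} [Field k] [Field K] [Algebra k K] {m n : ℕ}
  {P : Ideal (GenRing k m n)} [P.IsPrime]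

/-- All entries of a matrix over `S` specialize. -/
def MatSpecializes {ι ι' : Type} (A : Matrix ι ι' (Localization.AtPrime P)) (α : Fin m → K)
    (p : Ideal (SpecRing k n α)) [p.IsPrime] : Prop :=
  ∀ i j, Specializes P α p (A i j)

/-- The specialization `A_α` of a matrix `A` over `S`. -/
noncomputable def specMat {ι ι' : Type} (A : Matrix ι ι' (Localization.AtPrime P)) (α : Fin m → K)
    (p : Ideal (SpecRing k n α)) [p.IsPrime] : Matrix ι ι' (Localization.AtPrime p) :=
  A.map (specElem P α p)

theorem exists_matrix_common_denominator {ι ι' : Type} [Finite ι] [Finite ι']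
    (A : Matrix ι ι' (Localization.AtPrime P)) :
    ∃ (A₀ : Matrix ι ι' (PolRing k m n)) (g : PolRing k m n), incl k n m g ∉ P ∧
      polToLoc P g • A = A₀.map (polToLoc P) ∧
      ∀ {K : Type v} [Field K] [Algebra k K] (α : Fin m → K) (p : Ideal (SpecRing k n α))
        [p.IsPrime], subst k n α g ∉ p → MatSpecializes A α p ∧
          polToSpec α p g • specMat A α p = A₀.map (polToSpec α p) := by
  obtain ⟨f, g, hg, H⟩ := exists_common_denominator P fun x : ι × ι' => A x.1 x.2
  refine ⟨Matrix.of fun i j => f (i, j), g, hg, ?_, fun α p _ hgp => ?_⟩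
  · ext i j
    simpa [mul_comm] using H (i, j)
  · have key (i j) := isSpecOf_of_eq hg hgp (H (i, j))
    refine ⟨fun i j => (key i j).imp fun _ => And.left, ?_⟩
    ext i j
    obtain ⟨b, hb, hb'⟩ := key i j
    simpa [specMat, hb.specElem_eq, mul_comm] using hb'

theorem generically_matSpecializes (K : Type v) [Field K] [Algebra k K] {ι ι' : Type} [Finite ι]
    [Finite ι'] (A : Matrix ι ι' (Localization.AtPrime P)) :
    Generically K P fun α p _ => MatSpecializes A α p := by
  obtain ⟨A₀, g, hg, -, H⟩ := exists_matrix_common_denominator.{u, v} A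
  exact (generically_subst_notMem hg).mono fun α p _ h => (H α p h).1

/-- Exactness of a complex of finite free modules specializes. -/
theorem generically_exact (K : Type v) [Field K] [Algebra k K] {ι₁ ι₂ ι₃ : Type} [Fintype ι₁]
    [Fintype ι₂] [Fintype ι₃] {A : Matrix ι₂ ι₁ (Localization.AtPrime P)}
    {D : Matrix ι₃ ι₂ (Localization.AtPrime P)}
    (h : Function.Exact A.mulVecLin D.mulVecLin) :
    Generically K P fun α p _ =>
      Function.Exact (specMat A α p).mulVecLin (specMat D α p).mulVecLin := by
  obtain ⟨A₀, a, ha, hA, HA⟩ := exists_matrix_common_denominator.{u, v} A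
  obtain ⟨D₀, d, hd, hD, HD⟩ := exists_matrix_common_denominator.{u, v} D
  have ua := isUnit_polToLoc P ha
  have ud := isUnit_polToLoc P hd
  have hDA : D * A = 0 := by
    classical
    apply Matrix.toLin'.injective
    rw [Matrix.toLin'_mul, map_zero]
    exact h.linearMap_comp_eq_zero
  have hDA₀ : D₀ * A₀ = 0 := by
    apply Matrix.map_injective (polToLoc_injective P)
    change (D₀ * A₀).map (polToLoc P) = Matrix.map 0 (polToLoc P)
    rw [Matrix.map_mul, ← hA, ← hD, Matrix.smul_mul, Matrix.mul_smul, hDA, smul_zero, smul_zero,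
      Matrix.map_zero _ (map_zero _)]
  -- Exactness over S, expressed over k[u, X]: a syzygy of `D₀` is in the image of `A₀` up to a
  -- factor outside P.
  have hker (v : ι₂ → PolRing k m n) (hv : D₀.mulVec v = 0) :
      ∃ g : PolRing k m n, incl k n m g ∉ P ∧ ∃ w, g • v = A₀.mulVec w := by
    have h0 : D.mulVecLin (polToLoc P ∘ v) = 0 := by
      rw [← smul_eq_zero_iff_eq ud.unit, Units.smul_def, IsUnit.unit_spec, Matrix.mulVecLin_apply,
        ← Matrix.smul_mulVec, hD]
      ext i
      rw [← RingHom.map_mulVec, hv]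
      simp
    obtain ⟨w, hw⟩ := (h _).1 h0
    obtain ⟨w₀, e, he, hw₀⟩ := exists_common_denominator P w
    refine ⟨a * e, incl_mul_notMem P ha he, w₀, ?_⟩
    ext1 i
    apply polToLoc_injective P
    rw [RingHom.map_mulVec, ← hA, Matrix.smul_mulVec]
    have : (polToLoc P ∘ w₀) = polToLoc P e • w := by
      ext1 j
      simp [← hw₀, mul_comm]
    rw [this, Matrix.mulVec_smul, ← Matrix.mulVecLin_apply, hw]
    simp [mul_assoc]
  obtain ⟨s, f, hf⟩ := Submodule.fg_iff_exists_fin_generating_family.1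
    (IsNoetherian.noetherian (LinearMap.ker D₀.mulVecLin))
  have hfk (i : Fin s) : D₀.mulVec (f i) = 0 := by
    have : f i ∈ LinearMap.ker D₀.mulVecLin := hf ▸ Submodule.subset_span ⟨i, rfl⟩
    exact this
  choose g hg w hw using fun i => hker (f i) (hfk i)
  -- The syzygies of `D₀` are finitely generated, so one factor works for all of them.
  have hG : ∀ v, D₀.mulVec v = 0 → ∃ w, (∏ i, g i) • v = A₀.mulVec w := by
    intro v hv
    have hv' : v ∈ Submodule.span (PolRing k m n) (Set.range f) := by rw [hf]; exact hv
    have hle : Submodule.span (PolRing k m n) (Set.range f) ≤ (LinearMap.range A₀.mulVecLin).comap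
        (LinearMap.lsmul (PolRing k m n) (ι₂ → PolRing k m n) (∏ i, g i)) := by
      rw [Submodule.span_le]
      rintro _ ⟨i, rfl⟩
      obtain ⟨c, hc⟩ := Finset.dvd_prod_of_mem g (Finset.mem_univ i)
      refine ⟨c • w i, ?_⟩
      rw [Matrix.mulVecLin_apply, Matrix.mulVec_smul, ← hw, hc, LinearMap.lsmul_apply, mul_comm,
        mul_smul]
    obtain ⟨w, hw⟩ := hle hv'
    exact ⟨w, hw.symm⟩
  have hGP := incl_prod_notMem P Finset.univ fun i _ => hg i
  generalize ∏ i, g i = G at hG hGP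
  refine ((((generically_subst_notMem ha).and (generically_subst_notMem hd)).and
    (generically_subst_notMem hGP)).and (.of_almostAll (almostAll_syzygies D₀))).mono ?_
  rintro α p _ ⟨⟨⟨hap, hdp⟩, hGp⟩, hsyz⟩
  obtain ⟨-, hAp⟩ := HA α p hap
  obtain ⟨-, hDp⟩ := HD α p hdp
  have uap := isUnit_polToSpec hap
  have udp := isUnit_polToSpec hdp
  have uGp := isUnit_polToSpec hGp
  intro y
  constructor
  · intro hy
    rw [Matrix.mulVecLin_apply] at hy
    obtain ⟨⟨t, ht⟩, hty⟩ := IsLocalization.exist_integer_multiples_of_finite p.primeCompl y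
    choose y₀ hy₀ using hty
    have hy₀' : algebraMap (SpecRing k n α) (Localization.AtPrime p) ∘ y₀ =
        algebraMap _ (Localization.AtPrime p) t • y := by
      ext1 i
      simp [hy₀, Algebra.smul_def]
    have hz : (D₀.map (subst k n α)).mulVec y₀ = 0 := by
      ext1 i
      apply IsLocalization.injective (Localization.AtPrime p) p.primeCompl_le_nonZeroDivisors
      rw [RingHom.map_mulVec, hy₀', Matrix.mulVec_smul, Matrix.map_map, ← RingHom.coe_comp]
      change (_ • (D₀.map (polToSpec α p)).mulVec y) i = _
      rw [← hDp, Matrix.smul_mulVec, hy]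
      simp
    -- Specialized syzygies lie in the image of the specialized A because G(α, X) and the
    -- denominator of A are units in S_α.
    have hle : Submodule.span (SpecRing k n α)
        {w | ∃ v, D₀.mulVec v = 0 ∧ w = fun j => subst k n α (v j)} ≤
        ((LinearMap.range (specMat A α p).mulVecLin).restrictScalars (SpecRing k n α)).comap
          ((Algebra.linearMap (SpecRing k n α) (Localization.AtPrime p)).compLeft ι₂) := by
      rw [Submodule.span_le]
      rintro _ ⟨v, hv, rfl⟩
      obtain ⟨w, hw⟩ := hG v hv
      change (polToSpec α p) ∘ v ∈ LinearMap.range (specMat A α p).mulVecLin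
      rw [← Submodule.smul_mem_iff_of_isUnit _ uGp]
      refine ⟨polToSpec α p a • (polToSpec α p ∘ w), ?_⟩
      rw [Matrix.mulVecLin_apply, Matrix.mulVec_smul, ← Matrix.smul_mulVec, hAp]
      ext1 i
      rw [← RingHom.map_mulVec, ← hw]
      simp
    have := hle (hsyz y₀ hz)
    have ut : IsUnit (algebraMap (SpecRing k n α) (Localization.AtPrime p) t) :=
      IsLocalization.map_units _ (⟨t, ht⟩ : p.primeCompl)
    change algebraMap (SpecRing k n α) (Localization.AtPrime p) ∘ y₀ ∈
      LinearMap.range (specMat A α p).mulVecLin at this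
    rwa [hy₀', Submodule.smul_mem_iff_of_isUnit _ ut] at this
  · rintro ⟨w, rfl⟩
    rw [← smul_eq_zero_iff_eq udp.unit, ← smul_eq_zero_iff_eq uap.unit, Units.smul_def,
      Units.smul_def, IsUnit.unit_spec, IsUnit.unit_spec]
    simp only [Matrix.mulVecLin_apply, Matrix.mulVec_mulVec]
    rw [← Matrix.smul_mulVec, ← Matrix.smul_mulVec, ← Matrix.smul_mul, ← Matrix.mul_smul, hAp, hDp,
      ← Matrix.map_mul, hDA₀, Matrix.map_zero _ (map_zero _), Matrix.zero_mulVec]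

end SpecMatrix

end Specialization

namespace Specialization

/-! ### Matrix calculus for presentations -/

section Matrices

variable {T : Type w} [CommRing T]

theorem exists_matrix_mul_eq {ι κ κ' : Type} [Fintype κ] [Fintype κ']
    {A : Matrix ι κ T} {B : Matrix ι κ' T}
    (h : LinearMap.range B.mulVecLin ≤ LinearMap.range A.mulVecLin) :
    ∃ Y : Matrix κ κ' T, B = A * Y := by
  classical
  have (j : κ') : ∃ y : κ → T, A.mulVec y = B.col j := by
    obtain ⟨y, hy⟩ := h ⟨Pi.single j 1, rfl⟩
    exact ⟨y, by simpa using hy⟩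
  choose y hy using this
  refine ⟨Matrix.of fun i j => y j i, ?_⟩
  ext i j
  exact (congrFun (hy j) i).symm

theorem exists_exact_matrix [IsNoetherianRing T] {ι κ : Type} [Fintype ι] [Fintype κ]
    (A : Matrix ι κ T) :
    ∃ (z : ℕ) (Z : Matrix κ (Fin z) T), Function.Exact Z.mulVecLin A.mulVecLin := by
  classical
  obtain ⟨z, g, hg⟩ := Module.Finite.exists_fin' T (LinearMap.ker A.mulVecLin)
  refine ⟨z, LinearMap.toMatrix' ((LinearMap.ker A.mulVecLin).subtype ∘ₗ g), ?_⟩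
  rw [← Matrix.toLin'_apply', Matrix.toLin'_toMatrix', LinearMap.exact_iff,
    LinearMap.range_comp_of_range_eq_top _ (LinearMap.range_eq_top.2 hg), Submodule.range_subtype]

/-- The maps f, g are inverse to each other on the cokernels, up to the homotopies s, t. Encoding
the isomorphism in four matrix identities makes it transferable to specializations. -/
theorem nonempty_coker_equiv {ι₀ ι₁ κ₀ κ₁ : Type} [Fintype ι₀] [Fintype ι₁] [Fintype κ₀]
    [Fintype κ₁] [DecidableEq ι₀] [DecidableEq κ₀] {A : Matrix ι₀ ι₁ T} {B : Matrix κ₀ κ₁ T}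
    {f : Matrix κ₀ ι₀ T} {g : Matrix ι₀ κ₀ T} {f' : Matrix κ₁ ι₁ T} {g' : Matrix ι₁ κ₁ T}
    {s : Matrix ι₁ ι₀ T} {t : Matrix κ₁ κ₀ T} (hf : f * A = B * f') (hg : g * B = A * g')
    (hs : g * f = 1 + A * s) (ht : f * g = 1 + B * t) :
    Nonempty (((ι₀ → T) ⧸ LinearMap.range A.mulVecLin) ≃ₗ[T]
      ((κ₀ → T) ⧸ LinearMap.range B.mulVecLin)) := by
  have le {ι₀ ι₁ κ₀ κ₁ : Type} [Fintype ι₀] [Fintype ι₁] [Fintype κ₀] [Fintype κ₁]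
      {A : Matrix ι₀ ι₁ T} {B : Matrix κ₀ κ₁ T} {f : Matrix κ₀ ι₀ T} {f' : Matrix κ₁ ι₁ T}
      (hf : f * A = B * f') : LinearMap.range A.mulVecLin ≤
        (LinearMap.range B.mulVecLin).comap f.mulVecLin := by
    rintro _ ⟨x, rfl⟩
    exact ⟨f'.mulVec x, by simp [hf]⟩
  refine ⟨LinearEquiv.ofLinearMap (Submodule.mapQ _ _ f.mulVecLin (le hf))
    (Submodule.mapQ _ _ g.mulVecLin (le hg)) ?_ ?_⟩
  · refine Submodule.linearMap_qext _ (LinearMap.ext fun x => (Submodule.Quotient.eq _).2 ?_)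
    exact ⟨t.mulVec x, by simp [ht, Matrix.add_mulVec]⟩
  · refine Submodule.linearMap_qext _ (LinearMap.ext fun x => (Submodule.Quotient.eq _).2 ?_)
    exact ⟨s.mulVec x, by simp [hs, Matrix.add_mulVec]⟩

end Matrices

namespace FinFreePres

section

variable {S : Type u} [CommRing S] {M N : Type v} [AddCommGroup M] [Module S M]
  [AddCommGroup N] [Module S N]

/-- Transport of a presentation along an isomorphism. -/
def ofEquiv (F : FinFreePres S M) (e : M ≃ₗ[S] N) : FinFreePres S N where
  r₁ := F.r₁
  r₀ := F.r₀
  mat := F.mat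
  proj := e.toLinearMap ∘ₗ F.proj
  exact := by
    rw [LinearMap.exact_iff, LinearEquiv.ker_comp]
    exact LinearMap.exact_iff.1 F.exact
  surjective := e.surjective.comp F.surjective

theorem exists_comparison (F G : FinFreePres S M) :
    ∃ (f : Matrix (Fin G.r₀) (Fin F.r₀) S) (f' : Matrix (Fin G.r₁) (Fin F.r₁) S),
      f * F.mat = G.mat * f' ∧ G.proj ∘ₗ f.mulVecLin = F.proj := by
  obtain ⟨f, hf⟩ := Module.projective_lifting_property G.proj F.proj G.surjective
  have hf' : G.proj ∘ₗ (LinearMap.toMatrix' f).mulVecLin = F.proj := by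
    rwa [← Matrix.toLin'_apply', Matrix.toLin'_toMatrix']
  obtain ⟨f', h⟩ := exists_matrix_mul_eq (A := G.mat) (B := LinearMap.toMatrix' f * F.mat) (by
    rintro _ ⟨x, rfl⟩
    rw [← LinearMap.exact_iff.1 G.exact, LinearMap.mem_ker, Matrix.mulVecLin_mul,
      LinearMap.comp_apply, ← LinearMap.comp_apply G.proj, hf']
    exact F.exact.apply_apply_eq_zero x)
  exact ⟨_, f', h, hf'⟩

theorem exists_homotopy (F : FinFreePres S M) {f : Matrix (Fin F.r₀) (Fin F.r₀) S}
    (hf : F.proj ∘ₗ f.mulVecLin = F.proj) :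
    ∃ s : Matrix (Fin F.r₁) (Fin F.r₀) S, f = 1 + F.mat * s := by
  obtain ⟨s, h⟩ := exists_matrix_mul_eq (A := F.mat) (B := f - 1) (by
    rintro _ ⟨x, rfl⟩
    rw [← LinearMap.exact_iff.1 F.exact, LinearMap.mem_ker, Matrix.mulVecLin_apply,
      Matrix.sub_mulVec, map_sub, Matrix.one_mulVec, sub_eq_zero]
    exact LinearMap.congr_fun hf x)
  exact ⟨s, by rw [← h]; abel⟩

end

end FinFreePres

/-! ### Presenting the homology of a complex of powers of a module -/

section MatAct

set_option linter.unusedSectionVars false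

variable {T : Type w} [CommRing T] {ι ι' ι'' : Type} [Fintype ι] [Fintype ι'] [Fintype ι'']
  (N : Type w) [AddCommGroup N] [Module T N]

/-- The action of a matrix on vectors with entries in a module. -/
def matAct (E : Matrix ι ι' T) : (ι' → N) →ₗ[T] (ι → N) :=
  LinearMap.pi fun i => ∑ j, E i j • LinearMap.proj j

variable {N}

@[simp]
theorem matAct_apply (E : Matrix ι ι' T) (x : ι' → N) (i : ι) :
    matAct N E x i = ∑ j, E i j • x j := by
  simp [matAct]

theorem matAct_zero : matAct N (0 : Matrix ι ι' T) = 0 := by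
  ext1 x
  ext1 i
  simp

variable (N) in
/-- The homology of the pair of maps `N^ι'' → N^ι' → N^ι` given by the matrices `E₁` and `E₂`. -/
abbrev MatHomology (E₁ : Matrix ι' ι'' T) (E₂ : Matrix ι ι' T) : Type w :=
  LinearMap.ker (matAct N E₂) ⧸
    (LinearMap.range (matAct N E₁)).submoduleOf (LinearMap.ker (matAct N E₂))

/-- The map `(T^γ)^ι → N^ι` induced by `T^γ → N`. -/
def projPow (ι : Type) {γ : Type} (ρ : (γ → T) →ₗ[T] N) : (ι × γ → T) →ₗ[T] (ι → N) :=
  LinearMap.pi fun i => ρ ∘ₗ LinearMap.funLeft T T fun l => (i, l)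

theorem projPow_apply {γ : Type} (ρ : (γ → T) →ₗ[T] N) (x : ι × γ → T) (i : ι) :
    projPow ι ρ x i = ρ fun l => x (i, l) := rfl

theorem projPow_surjective {γ : Type} {ρ : (γ → T) →ₗ[T] N} (hρ : Function.Surjective ρ) :
    Function.Surjective (projPow ι ρ) := by
  intro y
  choose x hx using fun i => hρ (y i)
  exact ⟨fun a => x a.1 a.2, funext hx⟩

open Kronecker

variable {γ γ' : Type} [Fintype γ] [Fintype γ'] [DecidableEq ι] [DecidableEq γ] [DecidableEq γ']

theorem kronecker_one_mulVec (E : Matrix ι ι' T) (x : ι' × γ → T) (i : ι) (l : γ) :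
    (E ⊗ₖ (1 : Matrix γ γ T)).mulVec x (i, l) = ∑ j, E i j * x (j, l) := by
  simp [Matrix.mulVec, dotProduct, Fintype.sum_prod_type, Matrix.one_apply]

theorem one_kronecker_mulVec (C : Matrix γ γ' T) (x : ι × γ' → T) (i : ι) (l : γ) :
    ((1 : Matrix ι ι T) ⊗ₖ C).mulVec x (i, l) = C.mulVec (fun l' => x (i, l')) l := by
  simp [Matrix.mulVec, dotProduct, Fintype.sum_prod_type, Matrix.one_apply]

theorem matAct_projPow (E : Matrix ι ι' T) (ρ : (γ → T) →ₗ[T] N) (x : ι' × γ → T) :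
    matAct N E (projPow ι' ρ x) = projPow ι ρ ((E ⊗ₖ (1 : Matrix γ γ T)).mulVec x) := by
  ext1 i
  simp only [matAct_apply, projPow_apply, ← map_smul, ← map_sum]
  congr 1
  ext1 l
  simp [kronecker_one_mulVec]

theorem exact_projPow {C : Matrix γ γ' T} {ρ : (γ → T) →ₗ[T] N}
    (h : Function.Exact C.mulVecLin ρ) :
    Function.Exact ((1 : Matrix ι ι T) ⊗ₖ C).mulVecLin (projPow ι ρ) := by
  intro x
  constructor
  · intro hx
    choose y hy using fun i => (h _).1 (congrFun hx i)
    exact ⟨fun a => y a.1 a.2, funext fun ⟨i, l⟩ =>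
      (one_kronecker_mulVec C _ i l).trans (congrFun (hy i) l)⟩
  · rintro ⟨y, rfl⟩
    ext1 i
    rw [projPow_apply]
    refine Eq.trans (congrArg ρ ?_) (h.apply_apply_eq_zero fun l => y (i, l))
    ext1 l
    exact one_kronecker_mulVec C _ i l

variable [DecidableEq ι']

/-- A presentation of the homology of `N^ι'' → N^ι' → N^ι`, where `N` has the presentation
matrix `C`. -/
theorem exists_matHomology_proj {E₁ : Matrix ι' ι'' T} {E₂ : Matrix ι ι' T} {C : Matrix γ γ' T}
    {ρ : (γ → T) →ₗ[T] N} (hex : Function.Exact C.mulVecLin ρ) (hρ : Function.Surjective ρ)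
    {ζ ω : Type} [Fintype ζ] [Fintype ω] {Z₁ : Matrix (ι' × γ) ζ T} {Z₂ : Matrix (ι × γ') ζ T}
    {W : Matrix ζ ω T} {Y : Matrix ζ ((ι'' × γ) ⊕ (ι' × γ')) T}
    (hZ : Function.Exact (Matrix.fromRows Z₁ Z₂).mulVecLin
      (Matrix.fromCols (E₂ ⊗ₖ (1 : Matrix γ γ T)) ((1 : Matrix ι ι T) ⊗ₖ C)).mulVecLin)
    (hW : Function.Exact W.mulVecLin Z₁.mulVecLin)
    (hY : Matrix.fromCols (E₁ ⊗ₖ (1 : Matrix γ γ T)) ((1 : Matrix ι' ι' T) ⊗ₖ C) = Z₁ * Y) :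
    ∃ π : (ζ → T) →ₗ[T] MatHomology N E₁ E₂, Function.Surjective π ∧
      Function.Exact (Matrix.fromCols W Y).mulVecLin π := by
  have hker (v : ζ → T) : projPow ι' ρ (Z₁.mulVec v) ∈ LinearMap.ker (matAct N E₂) := by
    have h := hZ.apply_apply_eq_zero v
    rw [Matrix.mulVecLin_apply, Matrix.mulVecLin_apply, Matrix.fromRows_mulVec,
      Matrix.fromCols_mulVec] at h
    simp only [Sum.elim_comp_inl, Sum.elim_comp_inr] at h
    rw [LinearMap.mem_ker, matAct_projPow, eq_neg_of_add_eq_zero_left h, map_neg, neg_eq_zero]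
    exact (exact_projPow hex).apply_apply_eq_zero _
  let π : (ζ → T) →ₗ[T] MatHomology N E₁ E₂ := Submodule.mkQ _ ∘ₗ
    (projPow ι' ρ ∘ₗ Z₁.mulVecLin).codRestrict (LinearMap.ker (matAct N E₂)) hker
  refine ⟨π, ?_, fun v => ?_⟩
  · refine (Submodule.mkQ_surjective _).comp ?_
    rintro ⟨y, hy⟩
    obtain ⟨x, rfl⟩ := projPow_surjective hρ y
    rw [LinearMap.mem_ker, matAct_projPow] at hy
    obtain ⟨t, ht⟩ := (exact_projPow hex _).1 hy
    obtain ⟨v, hv⟩ := (hZ (Sum.elim x (-t))).1 (by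
      rw [Matrix.mulVecLin_apply, Matrix.fromCols_mulVec]
      simp only [Sum.elim_comp_inl, Sum.elim_comp_inr]
      rw [Matrix.mulVec_neg, ← ht, Matrix.mulVecLin_apply, add_neg_cancel])
    refine ⟨v, Subtype.ext (congrArg (projPow ι' ρ) ?_)⟩
    rw [Matrix.mulVecLin_apply, Matrix.fromRows_mulVec] at hv
    exact congrArg (· ∘ Sum.inl) hv
  · have h1 : π v = 0 ↔ projPow ι' ρ (Z₁.mulVec v) ∈ LinearMap.range (matAct N E₁) :=
      Submodule.Quotient.mk_eq_zero _
    rw [h1]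
    constructor
    · rintro ⟨y, hy⟩
      obtain ⟨s, rfl⟩ := projPow_surjective hρ y
      rw [matAct_projPow, eq_comm, ← sub_eq_zero, ← map_sub] at hy
      obtain ⟨t, ht⟩ := (exact_projPow hex _).1 hy
      have h2 : Z₁.mulVec (v - Y.mulVec (Sum.elim s t)) = 0 := by
        rw [Matrix.mulVec_sub, Matrix.mulVec_mulVec, ← hY, Matrix.fromCols_mulVec]
        simp only [Sum.elim_comp_inl, Sum.elim_comp_inr]
        rw [← Matrix.mulVecLin_apply (1 ⊗ₖ C), ht]
        abel
      obtain ⟨w, hw⟩ := (hW _).1 h2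
      refine ⟨Sum.elim w (Sum.elim s t), ?_⟩
      rw [Matrix.mulVecLin_apply, Matrix.fromCols_mulVec]
      simp only [Sum.elim_comp_inl, Sum.elim_comp_inr]
      rw [← Matrix.mulVecLin_apply W, hw]
      abel
    · rintro ⟨x, rfl⟩
      refine ⟨projPow ι'' ρ (x ∘ Sum.inr ∘ Sum.inl), ?_⟩
      rw [Matrix.mulVecLin_apply, Matrix.fromCols_mulVec, Matrix.mulVec_add,
        ← Matrix.mulVecLin_apply W, ← Matrix.mulVecLin_apply Z₁, hW.apply_apply_eq_zero, zero_add,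
        Matrix.mulVec_mulVec, ← hY, Matrix.fromCols_mulVec, map_add, matAct_projPow]
      have h3 := (exact_projPow (ι := ι') hex).apply_apply_eq_zero ((x ∘ Sum.inr) ∘ Sum.inr)
      rw [Matrix.mulVecLin_apply] at h3
      rw [h3, add_zero]
      rfl

theorem exists_matHomology_data [IsNoetherianRing T] {E₁ : Matrix ι' ι'' T} {E₂ : Matrix ι ι' T}
    (hE : E₂ * E₁ = 0) (C : Matrix γ γ' T) :
    ∃ (z w : ℕ) (Z₁ : Matrix (ι' × γ) (Fin z) T) (Z₂ : Matrix (ι × γ') (Fin z) T)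
      (W : Matrix (Fin z) (Fin w) T) (Y : Matrix (Fin z) ((ι'' × γ) ⊕ (ι' × γ')) T),
      Function.Exact (Matrix.fromRows Z₁ Z₂).mulVecLin
        (Matrix.fromCols (E₂ ⊗ₖ (1 : Matrix γ γ T)) ((1 : Matrix ι ι T) ⊗ₖ C)).mulVecLin ∧
      Function.Exact W.mulVecLin Z₁.mulVecLin ∧
      Matrix.fromCols (E₁ ⊗ₖ (1 : Matrix γ γ T)) ((1 : Matrix ι' ι' T) ⊗ₖ C) = Z₁ * Y := by
  obtain ⟨z, Z, hZ⟩ := exists_exact_matrix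
    (Matrix.fromCols (E₂ ⊗ₖ (1 : Matrix γ γ T)) ((1 : Matrix ι ι T) ⊗ₖ C))
  rw [← Matrix.fromRows_toRows Z] at hZ
  obtain ⟨w, W, hW⟩ := exists_exact_matrix Z.toRows₁
  obtain ⟨Y, hY⟩ := exists_matrix_mul_eq (A := Z.toRows₁)
    (B := Matrix.fromCols (E₁ ⊗ₖ (1 : Matrix γ γ T)) ((1 : Matrix ι' ι' T) ⊗ₖ C)) (by
      rintro _ ⟨x, rfl⟩
      -- For a vector E₁s + Ct, applying E₂ gives CE₂t, since E₂E₁ = 0 and the two Kronecker factors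
      -- commute. So −E₂t completes it to an element of the kernel.
      obtain ⟨v, hv⟩ := (hZ (Sum.elim ((Matrix.fromCols (E₁ ⊗ₖ (1 : Matrix γ γ T))
        ((1 : Matrix ι' ι' T) ⊗ₖ C)).mulVec x)
        (-((E₂ ⊗ₖ (1 : Matrix γ' γ' T)).mulVec (x ∘ Sum.inr))))).1 (by
        rw [Matrix.mulVecLin_apply, Matrix.fromCols_mulVec, Matrix.fromCols_mulVec]
        simp only [Sum.elim_comp_inl, Sum.elim_comp_inr]
        rw [Matrix.mulVec_add, Matrix.mulVec_neg]
        simp only [Matrix.mulVec_mulVec, ← Matrix.mul_kronecker_mul, hE, Matrix.one_mul,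
          Matrix.mul_one, Matrix.zero_kronecker, Matrix.zero_mulVec]
        abel)
      refine ⟨v, ?_⟩
      rw [Matrix.mulVecLin_apply, Matrix.fromRows_mulVec] at hv
      exact congrArg (· ∘ Sum.inl) hv)
  exact ⟨z, w, _, _, W, Y, hZ, hW, hY⟩

end MatAct

end Specialization

namespace Specialization

/-! ### Specialization along a filter -/

section GenericHomology

theorem exact_submatrix {T : Type w} [CommRing T] {N : Type w} [AddCommGroup N] [Module T N]
    {ι ι' κ κ' : Type} [Fintype κ] [Fintype κ'] {A : Matrix ι κ T} (e₀ : ι' ≃ ι) (e : κ' ≃ κ)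
    {π : (ι → T) →ₗ[T] N} (h : Function.Exact A.mulVecLin π) :
    Function.Exact (A.submatrix e₀ e).mulVecLin (π ∘ₗ LinearMap.funLeft T T e₀.symm) := by
  have hA (x : κ' → T) : (A.submatrix e₀ e).mulVec x = A.mulVec (x ∘ e.symm) ∘ e₀ :=
    Matrix.submatrix_mulVec_equiv A x e₀ e
  intro y
  rw [LinearMap.comp_apply, h]
  constructor
  · rintro ⟨x, hx⟩
    refine ⟨x ∘ e, (hA _).trans ?_⟩
    rw [Function.comp_assoc, e.self_comp_symm, Function.comp_id, ← Matrix.mulVecLin_apply, hx]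
    ext1 i
    simp [LinearMap.funLeft_apply]
  · rintro ⟨x, rfl⟩
    refine ⟨x ∘ e.symm, ?_⟩
    rw [Matrix.mulVecLin_apply, Matrix.mulVecLin_apply, hA]
    ext1 i
    simp [LinearMap.funLeft_apply]

theorem surjective_comp_funLeft {T : Type w} [CommRing T] {N : Type w} [AddCommGroup N]
    [Module T N] {ι ι' : Type} (e₀ : ι' ≃ ι) {π : (ι → T) →ₗ[T] N} (h : Function.Surjective π) :
    Function.Surjective (π ∘ₗ LinearMap.funLeft T T e₀.symm) :=
  h.comp (LinearMap.funLeft_surjective_of_injective T T _ e₀.symm.injective)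

/-- A presentation with generators and relations indexed by arbitrary finite types. -/
theorem FinFreePres.exists_of_exact {T : Type w} [CommRing T] {N : Type w} [AddCommGroup N]
    [Module T N] {ι κ : Type} [Fintype ι] [Fintype κ] (A : Matrix ι κ T) (π : (ι → T) →ₗ[T] N)
    (h : Function.Exact A.mulVecLin π) (hπ : Function.Surjective π) :
    ∃ (G : FinFreePres T N) (e₀ : Fin G.r₀ ≃ ι) (e : Fin G.r₁ ≃ κ), G.mat = A.submatrix e₀ e :=
  ⟨⟨Fintype.card κ, Fintype.card ι, _, _,
    exact_submatrix (Fintype.equivFin ι).symm (Fintype.equivFin κ).symm h,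
    surjective_comp_funLeft (Fintype.equivFin ι).symm hπ⟩, _, _, rfl⟩

/-- A family of maps from `T` to rings `T' i` that, along a filter, behaves like a ring
homomorphism and preserves the exactness of complexes of finite free modules. -/
structure SpecFamily (T : Type u) [CommRing T] {I : Type*} (l : Filter I) (T' : I → Type v)
    [∀ i, CommRing (T' i)] where
  toFun : ∀ i, T → T' i
  map_zero : ∀ i, toFun i 0 = 0
  map_one : ∀ i, toFun i 1 = 1
  map_add : ∀ a b, ∀ᶠ i in l, toFun i (a + b) = toFun i a + toFun i b
  map_mul : ∀ a b, ∀ᶠ i in l, toFun i (a * b) = toFun i a * toFun i b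
  exact : ∀ {ι₁ ι₂ ι₃ : Type} [Fintype ι₁] [Fintype ι₂] [Fintype ι₃] (A : Matrix ι₂ ι₁ T)
    (D : Matrix ι₃ ι₂ T), Function.Exact A.mulVecLin D.mulVecLin →
    ∀ᶠ i in l, Function.Exact (A.map (toFun i)).mulVecLin (D.map (toFun i)).mulVecLin

namespace SpecFamily

variable {T : Type u} [CommRing T] {I : Type*} {l : Filter I} {T' : I → Type v}
    [∀ i, CommRing (T' i)] (σ : SpecFamily T l T') {ι ι' ι'' κ κ' : Type}

/-- The specialization of a matrix. -/
def mat (A : Matrix ι κ T) (i : I) : Matrix ι κ (T' i) := A.map (σ.toFun i)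

theorem map_sum [Finite κ] (s : Finset κ) (a : κ → T) :
    ∀ᶠ i in l, σ.toFun i (∑ j ∈ s, a j) = ∑ j ∈ s, σ.toFun i (a j) := by
  classical
  induction s using Finset.induction_on with
  | empty => exact .of_forall fun i => by simp [σ.map_zero]
  | insert x s hx ih =>
    filter_upwards [ih, σ.map_add (a x) (∑ j ∈ s, a j)] with i h₁ h₂
    rw [Finset.sum_insert hx, Finset.sum_insert hx, h₂, h₁]

theorem mat_mul [Finite ι] [Fintype κ] [Finite ι'] (A : Matrix ι κ T) (B : Matrix κ ι' T) :
    ∀ᶠ i in l, σ.mat (A * B) i = σ.mat A i * σ.mat B i := by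
  have h : ∀ᶠ i in l, ∀ x y, σ.mat (A * B) i x y = (σ.mat A i * σ.mat B i) x y := by
    refine Filter.eventually_all.2 fun x => Filter.eventually_all.2 fun y => ?_
    filter_upwards [σ.map_sum Finset.univ fun j => A x j * B j y,
      Filter.eventually_all.2 fun j => σ.map_mul (A x j) (B j y)] with i h₁ h₂
    exact h₁.trans (Finset.sum_congr rfl fun j _ => h₂ j)
  exact h.mono fun i hi => Matrix.ext hi

theorem mat_add [Finite ι] [Finite ι'] (A B : Matrix ι ι' T) :
    ∀ᶠ i in l, σ.mat (A + B) i = σ.mat A i + σ.mat B i := by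
  have h : ∀ᶠ i in l, ∀ x y, σ.mat (A + B) i x y = (σ.mat A i + σ.mat B i) x y :=
    Filter.eventually_all.2 fun x => Filter.eventually_all.2 fun y => σ.map_add (A x y) (B x y)
  exact h.mono fun i hi => Matrix.ext hi

theorem mat_one [DecidableEq ι] (i : I) : σ.mat (1 : Matrix ι ι T) i = 1 :=
  Matrix.map_one _ (σ.map_zero i) (σ.map_one i)

theorem mat_zero (i : I) : σ.mat (0 : Matrix ι κ T) i = 0 :=
  Matrix.map_zero _ (σ.map_zero i)

theorem mat_transpose (A : Matrix ι κ T) (i : I) : σ.mat A.transpose i = (σ.mat A i).transpose :=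
  rfl

theorem mat_fromCols (A : Matrix ι κ T) (B : Matrix ι κ' T) (i : I) :
    σ.mat (Matrix.fromCols A B) i = Matrix.fromCols (σ.mat A i) (σ.mat B i) := by
  ext x (y | y) <;> rfl

theorem mat_fromRows (A : Matrix ι κ T) (B : Matrix ι' κ T) (i : I) :
    σ.mat (Matrix.fromRows A B) i = Matrix.fromRows (σ.mat A i) (σ.mat B i) := by
  ext (x | x) y <;> rfl

open Kronecker

theorem mat_kronecker_one [DecidableEq κ] (A : Matrix ι ι' T) (i : I) :
    σ.mat (A ⊗ₖ (1 : Matrix κ κ T)) i = σ.mat A i ⊗ₖ (1 : Matrix κ κ (T' i)) := by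
  ext ⟨x, y⟩ ⟨x', y'⟩
  rcases eq_or_ne y y' with rfl | h
  · simp [mat]
  · simp [mat, h, σ.map_zero]

theorem mat_one_kronecker [DecidableEq κ] (A : Matrix ι ι' T) (i : I) :
    σ.mat ((1 : Matrix κ κ T) ⊗ₖ A) i = (1 : Matrix κ κ (T' i)) ⊗ₖ σ.mat A i := by
  ext ⟨y, x⟩ ⟨y', x'⟩
  rcases eq_or_ne y y' with rfl | h
  · simp [mat]
  · simp [mat, h, σ.map_zero]

variable {M : Type u} [AddCommGroup M] [Module T M]

/-- The specialization of a module with respect to a finite free presentation. -/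
abbrev Mod (F : FinFreePres T M) (i : I) : Type v :=
  (Fin F.r₀ → T' i) ⧸ LinearMap.range (σ.mat F.mat i).mulVecLin

/-- The presentation of the specialization of a module by the specialized matrix. -/
def pres (F : FinFreePres T M) (i : I) : FinFreePres (T' i) (σ.Mod F i) where
  r₁ := F.r₁
  r₀ := F.r₀
  mat := σ.mat F.mat i
  proj := Submodule.mkQ _
  exact := LinearMap.exact_map_mkQ_range _
  surjective := Submodule.mkQ_surjective _

/-- Up to isomorphism, the specialization of a module does not depend on the presentation. -/
theorem eventually_mod_equiv (F G : FinFreePres T M) :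
    ∀ᶠ i in l, Nonempty (σ.Mod F i ≃ₗ[T' i] σ.Mod G i) := by
  obtain ⟨f, f', hf, hf'⟩ := FinFreePres.exists_comparison F G
  obtain ⟨g, g', hg, hg'⟩ := FinFreePres.exists_comparison G F
  obtain ⟨s, hs⟩ := F.exists_homotopy (f := g * f) (by
    rw [Matrix.mulVecLin_mul, ← LinearMap.comp_assoc, hg', hf'])
  obtain ⟨t, ht⟩ := G.exists_homotopy (f := f * g) (by
    rw [Matrix.mulVecLin_mul, ← LinearMap.comp_assoc, hf', hg'])
  -- The comparison maps and homotopies over T amount to finitely many identities, each of which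
  -- specializes eventually.
  filter_upwards [σ.mat_mul f F.mat, σ.mat_mul G.mat f', σ.mat_mul g G.mat, σ.mat_mul F.mat g',
    σ.mat_mul g f, σ.mat_mul f g, σ.mat_mul F.mat s, σ.mat_mul G.mat t,
    σ.mat_add 1 (F.mat * s), σ.mat_add 1 (G.mat * t)] with i h₁ h₂ h₃ h₄ h₅ h₆ h₇ h₈ h₉ h₁₀
  refine nonempty_coker_equiv (f := σ.mat f i) (g := σ.mat g i) (f' := σ.mat f' i)
    (g' := σ.mat g' i) (s := σ.mat s i) (t := σ.mat t i) ?_ ?_ ?_ ?_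
  · rw [← h₁, hf, h₂]
  · rw [← h₃, hg, h₄]
  · rw [← h₅, hs, h₉, h₇, mat_one]
  · rw [← h₆, ht, h₁₀, h₈, mat_one]

/-- A presentation by generators and relations indexed by arbitrary finite types, together with
the modules that are presented by the specialized matrices. -/
theorem exists_finFreePres [Fintype ι] [Fintype κ] {A : Matrix ι κ T} {π : (ι → T) →ₗ[T] M}
    (hex : Function.Exact A.mulVecLin π) (hπ : Function.Surjective π) :
    ∃ G : FinFreePres T M, ∀ (i : I) (N : Type v) [AddCommGroup N] [Module (T' i) N]
      (π' : (ι → T' i) →ₗ[T' i] N), Function.Exact (σ.mat A i).mulVecLin π' →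
        Function.Surjective π' → Nonempty (N ≃ₗ[T' i] σ.Mod G i) := by
  obtain ⟨G, e₀, e, hG⟩ := FinFreePres.exists_of_exact A π hex hπ
  refine ⟨G, fun i N _ _ π' h hπ' => ?_⟩
  have h' := exact_submatrix e₀ e h
  have hA : (σ.mat A i).submatrix e₀ e = σ.mat G.mat i := by
    rw [hG]
    rfl
  rw [hA, LinearMap.exact_iff] at h'
  exact ⟨((Submodule.quotEquivOfEq _ _ h'.symm).trans
    (LinearMap.quotKerEquivOfSurjective _ (surjective_comp_funLeft e₀ hπ'))).symm⟩

/-- The specialization of the homology of a complex whose terms are powers of `M`. -/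
theorem exists_matHomology [IsNoetherianRing T] (F : FinFreePres T M) [Fintype ι] [Fintype ι']
    [Fintype ι''] [DecidableEq ι] [DecidableEq ι'] {E₁ : Matrix ι' ι'' T} {E₂ : Matrix ι ι' T}
    (hE : E₂ * E₁ = 0) :
    ∃ G : FinFreePres T (MatHomology M E₁ E₂), ∀ᶠ i in l,
      Nonempty (MatHomology (σ.Mod F i) (σ.mat E₁ i) (σ.mat E₂ i) ≃ₗ[T' i] σ.Mod G i) := by
  obtain ⟨z, w, Z₁, Z₂, W, Y, hZ, hW, hY⟩ := exists_matHomology_data hE F.mat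
  obtain ⟨π, hπ, hex⟩ := exists_matHomology_proj F.exact F.surjective hZ hW hY
  obtain ⟨G, hG⟩ := σ.exists_finFreePres hex hπ
  refine ⟨G, ?_⟩
  -- These three conditions put the specialized data under `exists_matHomology_proj` again, with the
  -- specialized module and the same shape of presentation matrix.
  filter_upwards [σ.exact _ _ hZ, σ.exact _ _ hW, σ.mat_mul Z₁ Y] with i hZ' hW' hY'
  change Function.Exact (σ.mat _ i).mulVecLin (σ.mat _ i).mulVecLin at hZ' hW'
  rw [mat_fromRows, mat_fromCols, mat_kronecker_one, mat_one_kronecker] at hZ'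
  have hY'' := congrArg (σ.mat · i) hY
  simp only [mat_fromCols, mat_kronecker_one, mat_one_kronecker, hY'] at hY''
  obtain ⟨π', hπ', hex'⟩ := exists_matHomology_proj (σ.pres F i).exact (σ.pres F i).surjective
    hZ' hW' hY''
  refine hG i _ π' ?_ hπ'
  rw [mat_fromCols]
  exact hex'

end SpecFamily

end GenericHomology

end Specialization

namespace Specialization

open scoped TensorProduct

/-! ### Ext and Tor as homology of matrices -/

section DerivedFunctors

variable {T : Type w} [CommRing T]

theorem nonempty_homology_equiv (S : ShortComplex (ModuleCat.{w} T)) {A B C : Type w}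
    [AddCommGroup A] [Module T A] [AddCommGroup B] [Module T B] [AddCommGroup C] [Module T C]
    {f : A →ₗ[T] B} {g : B →ₗ[T] C} (e₁ : S.X₁ ≃ₗ[T] A) (e₂ : S.X₂ ≃ₗ[T] B) (e₃ : S.X₃ ≃ₗ[T] C)
    (hf : ∀ x, e₂ (S.f x) = f (e₁ x)) (hg : ∀ x, e₃ (S.g x) = g (e₂ x)) :
    Nonempty (S.homology ≃ₗ[T]
      (LinearMap.ker g ⧸ (LinearMap.range f).submoduleOf (LinearMap.ker g))) := by
  have hk (x : S.X₂) : x ∈ LinearMap.ker S.g.hom ↔ e₂ x ∈ LinearMap.ker g := by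
    rw [LinearMap.mem_ker, LinearMap.mem_ker, ← hg]
    exact e₃.map_eq_zero_iff.symm
  let e : LinearMap.ker S.g.hom ≃ₗ[T] LinearMap.ker g :=
    e₂.ofSubmodules _ _ (by
      ext y
      obtain ⟨x, rfl⟩ := e₂.surjective y
      simpa using hk x)
  refine ⟨S.moduleCatHomologyIso.toLinearEquiv.trans (Submodule.Quotient.equiv _ _ e ?_)⟩
  ext y
  constructor
  · rintro ⟨_, ⟨x, rfl⟩, rfl⟩
    exact ⟨e₁ x, (hf x).symm⟩
  · rintro ⟨x, hx⟩
    obtain ⟨x, rfl⟩ := e₁.surjective x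
    refine ⟨S.moduleCatToCycles x, ⟨x, rfl⟩, Subtype.ext ?_⟩
    exact (hf x).trans hx

/-- A resolution of `L` by finite free modules. -/
structure FreeRes (r : ℕ → ℕ) (D : ∀ i, Matrix (Fin (r i)) (Fin (r (i + 1))) T) (L : Type w)
    [AddCommGroup L] [Module T L] where
  π : (Fin (r 0) → T) →ₗ[T] L
  surjective : Function.Surjective π
  exact_zero : Function.Exact (D 0).mulVecLin π
  exact_succ : ∀ i, Function.Exact (D (i + 1)).mulVecLin (D i).mulVecLin

/-- The differential from degree `i` to degree `i - 1`, which is `0` for `i = 0`. -/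
def backMat {r : ℕ → ℕ} (D : ∀ i, Matrix (Fin (r i)) (Fin (r (i + 1))) T) :
    ∀ i, Matrix (Fin (r (i - 1))) (Fin (r i)) T
  | 0 => 0
  | i + 1 => D i

namespace FreeRes

variable {r : ℕ → ℕ} {D : ∀ i, Matrix (Fin (r i)) (Fin (r (i + 1))) T} {L : Type w}
    [AddCommGroup L] [Module T L]

theorem mul_eq_zero (F : FreeRes r D L) (i : ℕ) : D i * D (i + 1) = 0 := by
  apply Matrix.toLin'.injective
  rw [Matrix.toLin'_mul, map_zero]
  exact (F.exact_succ i).linearMap_comp_eq_zero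

theorem backMat_mul (F : FreeRes r D L) (i : ℕ) : backMat D i * D i = 0 := by
  cases i with
  | zero => exact Matrix.zero_mul _
  | succ i => exact F.mul_eq_zero i

/-- The chain complex of a free resolution. -/
noncomputable def complex (F : FreeRes r D L) : ChainComplex (ModuleCat.{w} T) ℕ :=
  ChainComplex.of (fun i => ModuleCat.of T (Fin (r i) → T))
    (fun i => ModuleCat.ofHom (D i).mulVecLin) fun i => by
      ext1
      exact (F.exact_succ i).linearMap_comp_eq_zero

theorem complex_d (F : FreeRes r D L) (i : ℕ) :
    F.complex.d (i + 1) i = ModuleCat.ofHom (D i).mulVecLin :=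
  ChainComplex.of_d (fun i => ModuleCat.of T (Fin (r i) → T))
    (fun i => ModuleCat.ofHom (D i).mulVecLin) _

/-- The projective resolution given by a free resolution. -/
noncomputable def projectiveResolution (F : FreeRes r D L) :
    ProjectiveResolution (ModuleCat.of T L) where
  complex := F.complex
  projective i := ModuleCat.projective_of_free (M := ModuleCat.of T (Fin (r i) → T))
    (Pi.basisFun T (Fin (r i)))
  π := (ChainComplex.toSingle₀Equiv _ _).symm ⟨ModuleCat.ofHom F.π, by
    rw [complex_d]
    ext1
    exact F.exact_zero.linearMap_comp_eq_zero⟩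
  quasiIso := ⟨fun n => by
    cases n with
    | zero =>
      rw [ChainComplex.quasiIsoAt₀_iff, ShortComplex.quasiIso_iff_of_zeros']
      · refine (ShortComplex.exact_and_epi_g_iff_of_iso
          (S₂ := ShortComplex.mk (ModuleCat.ofHom (D 0).mulVecLin) (ModuleCat.ofHom F.π) (by
            ext1
            exact F.exact_zero.linearMap_comp_eq_zero)) ?_).2
          ⟨?_, ?_⟩
        · exact ShortComplex.isoMk (Iso.refl _) (Iso.refl _) (Iso.refl _)
            ((Category.id_comp _).trans ((F.complex_d 0).symm.trans (Category.comp_id _).symm)) ((Category.id_comp _).trans (Category.comp_id _).symm)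
        · rw [ShortComplex.ShortExact.moduleCat_exact_iff_function_exact]
          exact F.exact_zero
        · rw [ModuleCat.epi_iff_surjective]
          exact F.surjective
      all_goals rfl
    | succ n =>
      rw [quasiIsoAt_iff_exactAt' _ _ (ChainComplex.exactAt_succ_single_obj _ _),
        HomologicalComplex.exactAt_iff' _ (n + 1 + 1) (n + 1) n (by simp) (by simp),
        ShortComplex.ShortExact.moduleCat_exact_iff_function_exact]
      change Function.Exact (F.complex.d (n + 1 + 1) (n + 1)) (F.complex.d (n + 1) n)
      rw [complex_d, complex_d]
      exact F.exact_succ n⟩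

variable (M : Type w) [AddCommGroup M] [Module T M]

/-- Hom(T^r, M) is M^r, and precomposition with D becomes the action of its transpose. -/
theorem nonempty_ext_equiv (F : FreeRes r D L) (i : ℕ) :
    Nonempty (ExtModule T L M i ≃ₗ[T]
      MatHomology M (backMat D i).transpose (D i).transpose) := by
  let K := F.projectiveResolution.complex.linearYonedaObj T (ModuleCat.of T M)
  let e (j : ℕ) : K.X j ≃ₗ[T] (Fin (r j) → M) :=
    (ModuleCat.homLinearEquiv (S := T)).trans (LinearEquiv.piRing T M (Fin (r j)) T)
  have hd (j : ℕ) (x : K.X j) : e (j + 1) (K.d j (j + 1) x) = matAct M (D j).transpose (e j x) := by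
    have : F.projectiveResolution.complex.d (j + 1) j = ModuleCat.ofHom (D j).mulVecLin :=
      F.complex_d j
    ext1 a
    change (F.projectiveResolution.complex.d (j + 1) j ≫ x).hom (Pi.single a 1) = _
    rw [this, matAct_apply]
    change x.hom ((D j).mulVec (Pi.single a 1)) = ∑ b, D j b a • x.hom (Pi.single b 1)
    have h : (D j).mulVec (Pi.single a 1) = ∑ b, D j b a • (Pi.single b 1 : Fin (r j) → T) := by
      ext b
      simp [Pi.single_apply]
    have h' (y : (Fin (r j) → T) →ₗ[T] M) :
        y ((D j).mulVec (Pi.single a 1)) = ∑ b, D j b a • y (Pi.single b 1) := by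
      rw [h, map_sum]
      exact Finset.sum_congr rfl fun b _ => map_smul _ _ _
    exact h' _
  -- In degree 0 the truncated index i - 1 is again 0, so the incoming map is this zero
  -- differential, matching `backMat D 0`.
  have h0 : K.d 0 0 = 0 := K.shape 0 0 (by simp)
  obtain ⟨h⟩ := nonempty_homology_equiv (K.sc' (i - 1) i (i + 1)) (e (i - 1)) (e i) (e (i + 1))
    (f := matAct M (backMat D i).transpose) (g := matAct M (D i).transpose) (by
      cases i with
      | zero =>
        intro x
        change e 0 (K.d 0 0 x) = matAct M (0 : Matrix (Fin (r 0)) (Fin (r 0)) T).transpose _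
        rw [h0, Matrix.transpose_zero, matAct_zero]
        exact (e 0).map_zero
      | succ i => exact hd i) (hd i)
  refine ⟨LinearEquiv.trans (Iso.toLinearEquiv ?_) h⟩
  refine F.projectiveResolution.isoExt i (ModuleCat.of T M) ≪≫
    ShortComplex.homologyMapIso (K.isoSc' (i - 1) i (i + 1) ?_ (CochainComplex.next ℕ i))
  cases i with
  | zero => exact CochainComplex.prev_nat_zero
  | succ i => exact CochainComplex.prev_nat_succ i

/-- Tor is derived here in its second argument, so the resolved module stands on the right; M ⊗ T^r
is M^r, with D acting on it. -/
theorem nonempty_tor_equiv (F : FreeRes r D L) (i : ℕ) :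
    Nonempty (TorModule T M L i ≃ₗ[T] MatHomology M (D i) (backMat D i)) := by
  let K := (((MonoidalCategory.tensoringLeft (ModuleCat.{w} T)).obj
    (ModuleCat.of T M)).mapHomologicalComplex _).obj F.projectiveResolution.complex
  let e (j : ℕ) : K.X j ≃ₗ[T] (Fin (r j) → M) := TensorProduct.piScalarRight T T M (Fin (r j))
  have hd (j : ℕ) (x : K.X (j + 1)) : e j (K.d (j + 1) j x) = matAct M (D j) (e (j + 1) x) := by
    have : F.projectiveResolution.complex.d (j + 1) j = ModuleCat.ofHom (D j).mulVecLin :=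
      F.complex_d j
    have hK : (K.d (j + 1) j).hom = (D j).mulVecLin.lTensor M := by
      change (MonoidalCategory.whiskerLeft (ModuleCat.of T M)
        (F.projectiveResolution.complex.d (j + 1) j)).hom = _
      rw [this]
      rfl
    change (e j).toLinearMap ((K.d (j + 1) j).hom x) = _
    rw [hK]
    change ((e j).toLinearMap ∘ₗ (D j).mulVecLin.lTensor M) x =
      (matAct M (D j) ∘ₗ (e (j + 1)).toLinearMap) x
    refine LinearMap.congr_fun (TensorProduct.ext' fun y v => ?_) x
    ext a
    change TensorProduct.piScalarRight T T M (Fin (r j)) (y ⊗ₜ[T] (D j).mulVec v) a =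
      matAct M (D j) (TensorProduct.piScalarRight T T M (Fin (r (j + 1))) (y ⊗ₜ[T] v)) a
    simp only [Matrix.mulVec, dotProduct, Finset.sum_smul, matAct_apply,
      TensorProduct.piScalarRight_apply, TensorProduct.piScalarRightHom_tmul]
    exact Finset.sum_congr rfl fun b _ => mul_smul (D j a b) (v b) (y : M)
  have h0 : K.d 0 0 = 0 := K.shape 0 0 (by simp)
  obtain ⟨h⟩ := nonempty_homology_equiv (K.sc' (i + 1) i (i - 1)) (e (i + 1)) (e i) (e (i - 1))
    (f := matAct M (D i)) (g := matAct M (backMat D i)) (hd i) (by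
      cases i with
      | zero =>
        intro x
        change e 0 (K.d 0 0 x) = matAct M (0 : Matrix (Fin (r 0)) (Fin (r 0)) T) _
        rw [h0, matAct_zero]
        exact (e 0).map_zero
      | succ i => exact hd i)
  refine ⟨LinearEquiv.trans (Iso.toLinearEquiv ?_) h⟩
  refine F.projectiveResolution.isoLeftDerivedObj _ i ≪≫
    ShortComplex.homologyMapIso (K.isoSc' (i + 1) i (i - 1) (ChainComplex.prev ℕ i) ?_)
  cases i with
  | zero => exact ChainComplex.next_nat_zero
  | succ i => exact ChainComplex.next_nat_succ i

end FreeRes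

end DerivedFunctors

end Specialization

namespace Specialization

/-! ### Hilbert's syzygy theorem and localization -/

section ProjectiveDimension

/-- The projective dimension of the `R`-module `M` is at most `d`. -/
abbrev PdLE (R : Type u) [CommRing R] (M : Type u) [AddCommGroup M] [Module R M] (d : ℕ) : Prop :=
  HasProjectiveDimensionLE (ModuleCat.of R M) d

variable {R : Type u} [CommRing R] {A B C : Type u} [AddCommGroup A] [Module R A]
  [AddCommGroup B] [Module R B] [AddCommGroup C] [Module R C] {d : ℕ}

theorem shortExact_ofHom {f : A →ₗ[R] B} {g : B →ₗ[R] C} (hf : Function.Injective f)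
    (hex : Function.Exact f g) (hg : Function.Surjective g) :
    (ShortComplex.mk (ModuleCat.ofHom f) (ModuleCat.ofHom g)
      (by ext1; exact hex.linearMap_comp_eq_zero)).ShortExact where
  exact := by
    rw [ShortComplex.ShortExact.moduleCat_exact_iff_function_exact]
    exact hex
  mono_f := (ModuleCat.mono_iff_injective _).2 hf
  epi_g := (ModuleCat.epi_iff_surjective _).2 hg

theorem pdLE_zero_iff : PdLE R A 0 ↔ Module.Projective R A := by
  rw [PdLE, ← projective_iff_hasProjectiveDimensionLE_zero, ← IsProjective.iff_projective]

theorem PdLE.of_equiv (h : PdLE R A d) (e : A ≃ₗ[R] B) : PdLE R B d :=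
  ModuleCat.hasProjectiveDimensionLE_of_linearEquiv (M := ModuleCat.of R A) e d

theorem PdLE.of_exact {f : A →ₗ[R] B} {g : B →ₗ[R] C} (hf : Function.Injective f)
    (hex : Function.Exact f g) (hg : Function.Surjective g) (hA : PdLE R A d) (hB : PdLE R B d) :
    PdLE R C (d + 1) :=
  (shortExact_ofHom hf hex hg).hasProjectiveDimensionLT_X₃ (d + 1) hA
    (hasProjectiveDimensionLT_of_ge _ (d + 1) _ (by lia))

theorem pdLE_succ_iff {f : A →ₗ[R] B} {g : B →ₗ[R] C} (hf : Function.Injective f)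
    (hex : Function.Exact f g) (hg : Function.Surjective g) (hB : Module.Projective R B) :
    PdLE R C (d + 1) ↔ PdLE R A d :=
  (shortExact_ofHom hf hex hg).hasProjectiveDimensionLT_X₃_iff d
    ((IsProjective.iff_projective B).1 hB)

open Polynomial TensorProduct

theorem PdLE.baseChange (R' : Type u) [CommRing R'] [Algebra R R'] [Module.Flat R R']
    (h : PdLE R A d) : PdLE R' (R' ⊗[R] A) d := by
  induction d generalizing A with
  | zero =>
    rw [pdLE_zero_iff] at h ⊢
    infer_instance
  | succ d ih =>
    have key {F : Type u} [AddCommGroup F] [Module R F] [Module.Projective R F] {π : F →ₗ[R] A}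
        (hπ : Function.Surjective π) : PdLE R' (R' ⊗[R] A) (d + 1) := by
      have hex := LinearMap.exact_subtype_ker_map π
      have hi := (LinearMap.ker π).injective_subtype
      rw [pdLE_succ_iff hi hex hπ inferInstance] at h
      exact (pdLE_succ_iff (f := (LinearMap.ker π).subtype.baseChange R') (g := π.baseChange R')
        (Module.Flat.lTensor_preserves_injective_linearMap _ hi) (lTensor_exact R' hex hπ)
        (LinearMap.lTensor_surjective R' hπ) inferInstance).2 (ih h)
    exact key (Finsupp.linearCombination_id_surjective R A)

section PolynomialModule

variable (R) (N : Type u) [AddCommGroup N] [Module R N] [Module R[X] N] [IsScalarTower R R[X] N]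

/-- Evaluation `N[X] → N` at the endomorphism of `N` given by `X`. -/
noncomputable def evalX : PolynomialModule R N →ₗ[R[X]] N where
  toFun q := PolynomialModule.eval Polynomial.X
    (PolynomialModule.map R[X] (LinearMap.id (R := R)) q)
  map_add' p q := by simp
  map_smul' p q := by
    rw [PolynomialModule.map_smul, PolynomialModule.eval_smul, RingHom.id_apply,
      Polynomial.algebraMap_eq, Polynomial.eval_map, Polynomial.eval₂_C_X]

theorem evalX_single (i : ℕ) (y : N) :
    evalX R N (PolynomialModule.single R i y) = (Polynomial.X ^ i : R[X]) • y := by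
  simp [evalX]

/-- The `R`-linear endomorphism of `N` given by `X`. -/
noncomputable def mulX : N →ₗ[R] N := Algebra.lsmul R R N (Polynomial.X : R[X])

/-- The difference of the two multiplications by `X` on `N[X]`. -/
noncomputable def subX : PolynomialModule R N →ₗ[R[X]] PolynomialModule R N where
  toFun q := (Polynomial.X : R[X]) • q - PolynomialModule.map R (mulX R N) q
  map_add' p q := by
    rw [smul_add, map_add]
    abel
  map_smul' p q := by
    rw [PolynomialModule.map_smul, RingHom.id_apply, smul_sub, smul_comm]
    simp

theorem subX_single (i : ℕ) (y : N) :
    subX R N (PolynomialModule.single R i y) = PolynomialModule.single R (i + 1) y -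
      PolynomialModule.single R i ((Polynomial.X : R[X]) • y) := by
  have : (Polynomial.X : R[X]) • PolynomialModule.single R i y =
      PolynomialModule.single R (i + 1) y := by
    rw [← Polynomial.monomial_one_one_eq_X, PolynomialModule.monomial_smul_single, one_smul,
      add_comm]
  simp [subX, this, mulX]

theorem coeff_subX_succ (q : PolynomialModule R N) (i : ℕ) :
    (subX R N q).coeff (i + 1) = q.coeff i - (Polynomial.X : R[X]) • q.coeff (i + 1) := by
  induction q using PolynomialModule.induction_linear with
  | zero => simp
  | add x y hx hy =>
    simp only [map_add, PolynomialModule.coeff_add, Finsupp.add_apply, smul_add, hx, hy]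
    abel
  | single j y =>
    have hneg (z : N) : -PolynomialModule.single R j z = PolynomialModule.single R j (-z) :=
      (map_neg (PolynomialModule.lsingle R j) z).symm
    rw [subX_single, sub_eq_add_neg, hneg]
    simp only [PolynomialModule.coeff_add, PolynomialModule.coeff_single, Finsupp.add_apply,
      Finsupp.single_apply]
    split_ifs <;> simp_all

/-- If q is killed, its coefficients satisfy q_i = X q_{i+1}, hence q_i = X^k q_{i+k} for all k, and
this vanishes once i + k exceeds the support. -/
theorem subX_injective : Function.Injective (subX R N) := by
  rw [injective_iff_map_eq_zero]
  intro q hq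
  have h (i : ℕ) : q.coeff i = (Polynomial.X : R[X]) • q.coeff (i + 1) := by
    rw [← sub_eq_zero, ← coeff_subX_succ, hq]
    rfl
  have h' (i k : ℕ) : q.coeff i = (Polynomial.X ^ k : R[X]) • q.coeff (i + k) := by
    induction k with
    | zero => simp
    | succ k ih => rw [ih, h (i + k), smul_smul, pow_succ, add_assoc]
  apply PolynomialModule.coeff_injective
  ext i
  obtain ⟨b, hb⟩ := q.coeff.support.bddAbove
  rw [h' i (b + 1), Finsupp.notMem_support_iff.1 fun hi => ?_, smul_zero]
  · rfl
  · have := hb hi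
    lia

/-- Modulo the image of the first map, every q is congruent to the constant given by its evaluation.
-/
theorem exact_subX_evalX : Function.Exact (subX R N) (evalX R N) := by
  refine fun q => ⟨fun hq => ?_, ?_⟩
  · have h (i : ℕ) (y : N) : PolynomialModule.single R i y -
        PolynomialModule.single R 0 ((Polynomial.X ^ i : R[X]) • y) ∈
          LinearMap.range (subX R N) := by
      induction i generalizing y with
      | zero => simp
      | succ i ih =>
        have := add_mem (LinearMap.mem_range_self (subX R N) (PolynomialModule.single R i y))
          (ih ((Polynomial.X : R[X]) • y))
        rwa [subX_single, smul_smul, ← pow_succ, sub_add_sub_cancel] at this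
    have h' (q : PolynomialModule R N) : q - PolynomialModule.single R 0 (evalX R N q) ∈
        LinearMap.range (subX R N) := by
      induction q using PolynomialModule.induction_linear with
      | zero => simp
      | add x y hx hy =>
        rw [map_add, PolynomialModule.single_add, add_sub_add_comm]
        exact add_mem hx hy
      | single i y =>
        rw [evalX_single]
        exact h i y
    simpa [hq] using h' q
  · rintro ⟨q, rfl⟩
    induction q using PolynomialModule.induction_linear with
    | zero => simp
    | add x y hx hy => rw [map_add, map_add, hx, hy, add_zero]
    | single i y =>
      rw [subX_single, map_sub, evalX_single, evalX_single, smul_smul, ← pow_succ, sub_self]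

theorem evalX_surjective : Function.Surjective (evalX R N) :=
  fun y => ⟨PolynomialModule.single R 0 y, by simp [evalX_single]⟩

end PolynomialModule

/-- The sequence 0 → N[X] → N[X] → N → 0 is exact, and N[X], being a flat base change of N from R,
has dimension at most d. -/
theorem pdLE_polynomial (h : ∀ (A : Type u) [AddCommGroup A] [Module R A], PdLE R A d)
    (N : Type u) [AddCommGroup N] [Module R[X] N] : PdLE R[X] N (d + 1) := by
  let : Module R N := Module.compHom N (Polynomial.C : R →+* R[X])
  have : IsScalarTower R R[X] N := IsScalarTower.of_algebraMap_smul fun _ _ => rfl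
  have h' : PdLE R[X] (PolynomialModule R N) d := ((h N).baseChange R[X]).of_equiv
    (PolynomialModule.polynomialTensorProductLEquivPolynomialModule R N)
  exact h'.of_exact (subX_injective R N) (exact_subX_evalX R N) (evalX_surjective R N) h'

theorem pdLE_of_ringEquiv {R' : Type u} [CommRing R'] (e : R ≃+* R')
    (h : ∀ (A : Type u) [AddCommGroup A] [Module R A], PdLE R A d)
    (N : Type u) [AddCommGroup N] [Module R' N] : PdLE R' N d := by
  let : Module R N := Module.compHom N (e : R →+* R')
  have := h N
  let := RingHomInvPair.of_ringEquiv e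
  let := RingHomInvPair.of_ringEquiv e.symm
  exact ModuleCat.hasProjectiveDimensionLE_of_semiLinearEquiv (M := ModuleCat.of R N) e
    { AddEquiv.refl N with map_smul' := fun _ _ => rfl } d

/-- Hilbert's syzygy theorem. -/
theorem pdLE_mvPolynomial (F : Type u) [Field F] (n : ℕ) (N : Type u) [AddCommGroup N]
    [Module (MvPolynomial (Fin n) F) N] : PdLE (MvPolynomial (Fin n) F) N n := by
  induction n generalizing N with
  | zero =>
    refine pdLE_of_ringEquiv (MvPolynomial.isEmptyRingEquiv F (Fin 0)).symm (fun A _ _ => ?_) N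
    rw [pdLE_zero_iff]
    infer_instance
  | succ n ih =>
    exact pdLE_of_ringEquiv (MvPolynomial.finSuccEquiv F n).symm.toRingEquiv
      (fun A _ _ => pdLE_polynomial ih A) N

/-- A module over the localization is the flat base change of its own restriction to R. -/
theorem pdLE_localization (S : Submonoid R)
    (h : ∀ (A : Type u) [AddCommGroup A] [Module R A], PdLE R A d) (N : Type u) [AddCommGroup N]
    [Module (Localization S) N] : PdLE (Localization S) N d := by
  let : Module R N := Module.compHom N (algebraMap R (Localization S))
  have : IsScalarTower R (Localization S) N := IsScalarTower.of_algebraMap_smul fun _ _ => rfl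
  exact ((h N).baseChange (Localization S)).of_equiv (IsLocalization.moduleLid S _ N)

end ProjectiveDimension

/-! ### Finite free resolutions over a local ring -/

section FiniteResolution

variable {T : Type u} [CommRing T] [IsNoetherianRing T] [IsLocalRing T]

/-- A finite projective kernel over a local ring is free, and Z is then taken from a basis.
Iterating this choice makes a resolution stop by itself once a projective syzygy is reached. -/
theorem exists_exact_matrix_of_local {ι κ : Type} [Fintype ι] [Fintype κ] (A : Matrix ι κ T) :
    ∃ (z : ℕ) (Z : Matrix κ (Fin z) T), Function.Exact Z.mulVecLin A.mulVecLin ∧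
      (Module.Projective T (LinearMap.ker A.mulVecLin) → Function.Injective Z.mulVecLin) ∧
      (Function.Injective A.mulVecLin → z = 0) := by
  classical
  by_cases h : Module.Projective T (LinearMap.ker A.mulVecLin)
  · have : Module.Free T (LinearMap.ker A.mulVecLin) := Module.free_of_flat_of_isLocalRing
    let b := Module.finBasis T (LinearMap.ker A.mulVecLin)
    let f := (LinearMap.ker A.mulVecLin).subtype ∘ₗ b.equivFun.symm.toLinearMap
    have hf : (LinearMap.toMatrix' f).mulVecLin = f := Matrix.toLin'_toMatrix' f
    refine ⟨_, LinearMap.toMatrix' f, ?_, fun _ => ?_, fun hA => ?_⟩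
    · rw [hf, LinearMap.exact_iff, LinearMap.range_comp_of_range_eq_top _ (LinearEquiv.range _),
        Submodule.range_subtype]
    · rw [hf]
      exact (Submodule.injective_subtype _).comp (LinearEquiv.injective _)
    · rw [LinearMap.ker_eq_bot.2 hA]
      exact Module.finrank_zero_of_subsingleton
  · obtain ⟨z, Z, hZ⟩ := exists_exact_matrix A
    refine ⟨z, Z, hZ, fun h' => absurd h' h, fun hA => absurd ?_ h⟩
    rw [LinearMap.ker_eq_bot.2 hA]
    infer_instance

theorem exists_freeRes {L : Type u} [AddCommGroup L] [Module T L] [Module.Finite T L] {d : ℕ}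
    (hL : PdLE T L d) : ∃ (r : ℕ → ℕ) (D : ∀ i, Matrix (Fin (r i)) (Fin (r (i + 1))) T),
      Nonempty (FreeRes r D L) ∧ ∃ N, ∀ i, N ≤ i → r i = 0 := by
  obtain ⟨G⟩ := FinFreePres.nonempty T L
  choose c Z hZ hinj hzero using
    fun x : Σ (a b : ℕ), Matrix (Fin a) (Fin b) T => exists_exact_matrix_of_local x.2.2
  -- A matrix is carried along with its dimensions, so that choosing syzygies can be iterated.
  let s : ℕ → Σ (a b : ℕ), Matrix (Fin a) (Fin b) T := fun i =>
    i.rec ⟨G.r₀, G.r₁, G.mat⟩ fun _ x => ⟨x.2.1, c x, Z x⟩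
  let r (i : ℕ) : ℕ := (s i).1
  let D (i : ℕ) : Matrix (Fin (r i)) (Fin (r (i + 1))) T := (s i).2.2
  have hex (i : ℕ) : Function.Exact (D (i + 1)).mulVecLin (D i).mulVecLin := hZ (s i)
  have hD (i : ℕ) : Module.Projective T (LinearMap.ker (D i).mulVecLin) →
      Function.Injective (D (i + 1)).mulVecLin := hinj (s i)
  have hr (i : ℕ) : Function.Injective (D i).mulVecLin → r (i + 2) = 0 := hzero (s i)
  let π : (Fin (r 0) → T) →ₗ[T] L := G.proj
  have hπ : Function.Exact (D 0).mulVecLin π := G.exact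
  refine ⟨r, D, ⟨⟨π, G.surjective, hπ, hex⟩⟩, d + 3, fun i hi => ?_⟩
  have hpd (e i : ℕ) (h : PdLE T (LinearMap.range (D i).mulVecLin) e) :
      Module.Projective T (LinearMap.range (D (i + e)).mulVecLin) := by
    induction e generalizing i with
    | zero => exact pdLE_zero_iff.1 h
    | succ e ih =>
      rw [add_comm e, ← add_assoc]
      refine ih _ ?_
      rw [← LinearMap.exact_iff.1 (hex i)]
      refine (pdLE_succ_iff (Submodule.injective_subtype _) (g := (D i).mulVecLin.rangeRestrict) ?_
        (LinearMap.surjective_rangeRestrict _) inferInstance).1 h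
      rw [LinearMap.exact_iff, LinearMap.ker_rangeRestrict, Submodule.range_subtype]
  have h0 : PdLE T (LinearMap.range (D 0).mulVecLin) d := by
    rw [← LinearMap.exact_iff.1 hπ]
    refine (pdLE_succ_iff (Submodule.injective_subtype _) (LinearMap.exact_subtype_ker_map π)
      G.surjective inferInstance).1 ?_
    exact hasProjectiveDimensionLT_of_ge _ (d + 1) _ (by lia)
  -- Weakened by one so that the projective module found is the range of `D (d + 1)`, that is, the
  -- kernel of `D d`. Then `D (d + 1)` is injective and `r (d + 3) = 0`.
  have h1 : PdLE T (LinearMap.range (D 0).mulVecLin) (d + 1) :=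
    hasProjectiveDimensionLT_of_ge _ (d + 1) _ (by lia)
  have h2 := hpd (d + 1) 0 h1
  rw [zero_add, ← LinearMap.exact_iff.1 (hex d)] at h2
  induction i, hi using Nat.le_induction with
  | base => exact hr (d + 1) (hD d h2)
  | succ i hi ih =>
    obtain ⟨i, rfl⟩ := Nat.exists_eq_add_of_le' (Nat.le_of_add_left_le hi : 1 ≤ i)
    refine hr i ?_
    have : IsEmpty (Fin (r (i + 1))) := by
      rw [ih]
      infer_instance
    exact Function.injective_of_subsingleton _

end FiniteResolution

end Specialization

namespace Specialization

/-! ### Specialization of Ext and Tor in all degrees -/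

section DerivedFunctors

variable {T : Type u} [CommRing T] {M : Type u} [AddCommGroup M] [Module T M]

/-- The presentation given by the first step of a free resolution. -/
def FreeRes.finFreePres {r : ℕ → ℕ} {D : ∀ i, Matrix (Fin (r i)) (Fin (r (i + 1))) T}
    (F : FreeRes r D M) : FinFreePres T M :=
  ⟨r 1, r 0, D 0, F.π, F.exact_zero, F.surjective⟩

theorem subsingleton_matHomology {ι ι' ι'' : Type} [Fintype ι] [Fintype ι'] [Fintype ι'']
    [IsEmpty ι'] (E₁ : Matrix ι' ι'' T) (E₂ : Matrix ι ι' T) :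
    Subsingleton (MatHomology M E₁ E₂) :=
  (Submodule.Quotient.mk_surjective _).subsingleton

/-- The presentation of a zero module without generators and relations. -/
def FinFreePres.ofSubsingleton [Subsingleton M] : FinFreePres T M where
  r₁ := 0
  r₀ := 0
  mat := 0
  proj := 0
  exact _ := iff_of_true (Subsingleton.elim _ _) ⟨0, Subsingleton.elim _ _⟩
  surjective _ := ⟨0, Subsingleton.elim _ _⟩

theorem exact_equiv_comp_mkQ {ι κ : Type} [Fintype κ] (A : Matrix ι κ T)
    (e : ((ι → T) ⧸ LinearMap.range A.mulVecLin) ≃ₗ[T] M) :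
    Function.Exact A.mulVecLin (e.toLinearMap ∘ₗ Submodule.mkQ _) := by
  rw [LinearMap.exact_iff, LinearEquiv.ker_comp, Submodule.ker_mkQ]

namespace SpecFamily

variable {I : Type*} {l : Filter I} {T' : I → Type v} [∀ i, CommRing (T' i)]
  (σ : SpecFamily T l T')

theorem mat_backMat {r : ℕ → ℕ} (D : ∀ i, Matrix (Fin (r i)) (Fin (r (i + 1))) T) (j : ℕ) (i : I) :
    σ.mat (backMat D j) i = backMat (fun j => σ.mat (D j) i) j := by
  cases j with
  | zero => exact σ.mat_zero i
  | succ j => rfl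

/-- The specialization of a finite free resolution is a resolution. -/
theorem eventually_freeRes (F : FinFreePres T M) {r : ℕ → ℕ}
    {D : ∀ i, Matrix (Fin (r i)) (Fin (r (i + 1))) T} (hF : FreeRes r D M)
    (hr : ∃ N, ∀ i, N ≤ i → r i = 0) :
    ∀ᶠ i in l, Nonempty (FreeRes r (fun j => σ.mat (D j) i) (σ.Mod F i)) := by
  obtain ⟨N, hN⟩ := hr
  -- The resolution specializes to one of the cokernel of its own first matrix, which is then
  -- identified with the specialization along `F`. Exactness is a condition only below N, beyond
  -- which the terms vanish.
  filter_upwards [σ.eventually_mod_equiv hF.finFreePres F,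
    Filter.eventually_all.2 fun j : Fin N => σ.exact _ _ (hF.exact_succ j)] with i ⟨e⟩ h
  refine ⟨⟨e.toLinearMap ∘ₗ Submodule.mkQ _,
    e.surjective.comp (Submodule.mkQ_surjective _), ?_, fun j => ?_⟩⟩
  · exact exact_equiv_comp_mkQ _ e
  · by_cases hj : j < N
    · exact h ⟨j, hj⟩
    · have : IsEmpty (Fin (r (j + 1))) := by
        rw [hN (j + 1) (by lia)]
        infer_instance
      have : IsEmpty (Fin (r j)) := by
        rw [hN j (by lia)]
        infer_instance
      exact fun x => iff_of_true (Subsingleton.elim _ _) ⟨0, Subsingleton.elim _ _⟩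

variable [IsNoetherianRing T] (F : FinFreePres T M)

/-- The specialization of the homology of a sequence of pairs of matrices, simultaneously in all
degrees. -/
theorem exists_matHomology_forall {r s t : ℕ → ℕ} {E₁ : ∀ j, Matrix (Fin (s j)) (Fin (r j)) T}
    {E₂ : ∀ j, Matrix (Fin (t j)) (Fin (s j)) T} (hE : ∀ j, E₂ j * E₁ j = 0)
    (hs : ∃ N, ∀ j, N ≤ j → s j = 0) :
    ∃ G : ∀ j, FinFreePres T (MatHomology M (E₁ j) (E₂ j)),
      (∃ N, ∀ j, N ≤ j → (G j).r₀ = 0) ∧ ∀ᶠ i in l, ∀ j,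
        Nonempty (MatHomology (σ.Mod F i) (σ.mat (E₁ j) i) (σ.mat (E₂ j) i) ≃ₗ[T' i]
          σ.Mod (G j) i) := by
  obtain ⟨N, hN⟩ := hs
  have (j : ℕ) : ∃ G : FinFreePres T (MatHomology M (E₁ j) (E₂ j)), (∀ᶠ i in l,
      Nonempty (MatHomology (σ.Mod F i) (σ.mat (E₁ j) i) (σ.mat (E₂ j) i) ≃ₗ[T' i]
        σ.Mod G i)) ∧ (N ≤ j → G.r₀ = 0 ∧ ∀ i,
      Nonempty (MatHomology (σ.Mod F i) (σ.mat (E₁ j) i) (σ.mat (E₂ j) i) ≃ₗ[T' i]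
        σ.Mod G i)) := by
    by_cases hj : N ≤ j
    · have : IsEmpty (Fin (s j)) := by
        rw [hN j hj]
        infer_instance
      have := subsingleton_matHomology (M := M) (E₁ j) (E₂ j)
      have h (i : I) : Nonempty (MatHomology (σ.Mod F i) (σ.mat (E₁ j) i) (σ.mat (E₂ j) i) ≃ₗ[T' i]
          σ.Mod (FinFreePres.ofSubsingleton (M := MatHomology M (E₁ j) (E₂ j))) i) := by
        have := subsingleton_matHomology (M := σ.Mod F i) (σ.mat (E₁ j) i) (σ.mat (E₂ j) i)
        have : Subsingleton
            (σ.Mod (FinFreePres.ofSubsingleton (M := MatHomology M (E₁ j) (E₂ j))) i) :=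
          have : IsEmpty (Fin (FinFreePres.ofSubsingleton (T := T)
              (M := MatHomology M (E₁ j) (E₂ j))).r₀) := Fin.isEmpty'
          (Submodule.Quotient.mk_surjective _).subsingleton
        exact ⟨0⟩
      exact ⟨_, .of_forall h, fun _ => ⟨rfl, h⟩⟩
    · obtain ⟨G, hG⟩ := σ.exists_matHomology F (hE j)
      exact ⟨G, hG, fun h => absurd h hj⟩
  choose G hG hG' using this
  refine ⟨G, ⟨N, fun j hj => (hG' j hj).1⟩, ?_⟩
  -- A filter allows only finite intersections; from N on, the isomorphisms are between zero modules
  -- and hold at every point.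
  filter_upwards [Filter.eventually_all.2 fun j : Fin N => hG j] with i hi j
  by_cases hj : N ≤ j
  · exact (hG' j hj).2 i
  · exact hi ⟨j, not_le.1 hj⟩

variable {L : Type u} [AddCommGroup L] [Module T L] (FL : FinFreePres T L)
  {r : ℕ → ℕ} {D : ∀ i, Matrix (Fin (r i)) (Fin (r (i + 1))) T}

theorem exists_ext (hL : FreeRes r D L) (hr : ∃ N, ∀ i, N ≤ i → r i = 0) :
    ∃ G : ∀ j, FinFreePres T (ExtModule T L M j),
      (∃ N, ∀ j, N ≤ j → (G j).r₀ = 0) ∧ ∀ᶠ i in l, ∀ j, Nonempty (ExtModule (T' i) (σ.Mod FL i) (σ.Mod F i) j ≃ₗ[T' i] σ.Mod (G j) i) := by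
  obtain ⟨G, hG0, hG⟩ := σ.exists_matHomology_forall F
    (E₁ := fun j => (backMat D j).transpose) (E₂ := fun j => (D j).transpose) (fun j => by
      rw [← Matrix.transpose_mul, hL.backMat_mul, Matrix.transpose_zero]) hr
  refine ⟨fun j => (G j).ofEquiv (hL.nonempty_ext_equiv M j).some.symm, hG0, ?_⟩
  filter_upwards [hG, σ.eventually_freeRes FL hL hr] with i hi ⟨h⟩ j
  obtain ⟨e⟩ := h.nonempty_ext_equiv (σ.Mod F i) j
  obtain ⟨e'⟩ := hi j
  rw [mat_transpose, mat_transpose, mat_backMat] at e'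
  exact ⟨e.trans e'⟩

theorem exists_tor (hM : FreeRes r D M) (hr : ∃ N, ∀ i, N ≤ i → r i = 0) :
    ∃ G : ∀ j, FinFreePres T (TorModule T L M j),
      (∃ N, ∀ j, N ≤ j → (G j).r₀ = 0) ∧ ∀ᶠ i in l, ∀ j, Nonempty (TorModule (T' i) (σ.Mod FL i) (σ.Mod F i) j ≃ₗ[T' i] σ.Mod (G j) i) := by
  obtain ⟨G, hG0, hG⟩ := σ.exists_matHomology_forall FL
    (E₁ := D) (E₂ := backMat D) hM.backMat_mul hr
  refine ⟨fun j => (G j).ofEquiv (hM.nonempty_tor_equiv L j).some.symm, hG0, ?_⟩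
  filter_upwards [hG, σ.eventually_freeRes F hM hr] with i hi ⟨h⟩ j
  obtain ⟨e⟩ := h.nonempty_tor_equiv (σ.Mod FL i) j
  obtain ⟨e'⟩ := hi j
  rw [mat_backMat] at e'
  exact ⟨e.trans e'⟩

/-- Ext uses a resolution of L and a presentation of M; Tor uses a resolution of M and a
presentation of L. -/
theorem exists_ext_tor [IsLocalRing T] {d : ℕ}
    (h : ∀ (A : Type u) [AddCommGroup A] [Module T A], PdLE T A d) [Module.Finite T L]
    [Module.Finite T M] :
    ∃ (GE : ∀ j, FinFreePres T (ExtModule T L M j)) (GT : ∀ j, FinFreePres T (TorModule T L M j)),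
      (∃ N, ∀ j, N ≤ j → (GE j).r₀ = 0 ∧ (GT j).r₀ = 0) ∧ ∀ᶠ i in l, ∀ j,
        Nonempty (ExtModule (T' i) (σ.Mod FL i) (σ.Mod F i) j ≃ₗ[T' i] σ.Mod (GE j) i) ∧
        Nonempty (TorModule (T' i) (σ.Mod FL i) (σ.Mod F i) j ≃ₗ[T' i] σ.Mod (GT j) i) := by
  obtain ⟨r, D, ⟨hL⟩, hr⟩ := exists_freeRes (h L)
  obtain ⟨r', D', ⟨hM⟩, hr'⟩ := exists_freeRes (h M)
  obtain ⟨GE, ⟨N, hN⟩, hE⟩ := σ.exists_ext F FL hL hr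
  obtain ⟨GT, ⟨N', hN'⟩, hT⟩ := σ.exists_tor F FL hM hr'
  refine ⟨GE, GT, ⟨max N N', fun j hj => ⟨hN j (le_of_max_le_left hj),
    hN' j (le_of_max_le_right hj)⟩⟩, ?_⟩
  filter_upwards [hE, hT] with i hi hi' j
  exact ⟨hi j, hi' j⟩

end SpecFamily

end DerivedFunctors

end Specialization

namespace Specialization

/-! ### Application to S = R_P and the local rings S_α -/

section Localizations

variable {k : Type u} {K : Type v} [Field k] [Field K] [Algebra k K] {m n : ℕ}

/-- A point `α` of `K^m` together with an associated prime of `P_α`. -/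
structure SpecPoint (K : Type v) [Field K] [Algebra k K] (P : Ideal (GenRing k m n)) where
  α : Fin m → K
  p : Ideal (SpecRing k n α)
  isPrime : p.IsPrime
  isSpecPrime : IsSpecPrime α P p

instance {P : Ideal (GenRing k m n)} (x : SpecPoint K P) : x.p.IsPrime := x.isPrime

/-- The local ring `S_α` at a point. -/
def SpecPoint.Ring {P : Ideal (GenRing k m n)} (x : SpecPoint K P) : Type v :=
  Localization.AtPrime x.p

noncomputable instance {P : Ideal (GenRing k m n)} (x : SpecPoint K P) : CommRing x.Ring :=
  inferInstanceAs (CommRing (Localization.AtPrime x.p))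

/-- The filter of almost all points. -/
def specFilter (K : Type v) [Field K] [Algebra k K] (P : Ideal (GenRing k m n)) :
    Filter (SpecPoint K P) where
  sets := {s | AlmostAll K m fun α => ∀ x : SpecPoint K P, x.α = α → x ∈ s}
  univ_sets := AlmostAll.of_forall fun _ _ _ => trivial
  sets_of_superset h hs := h.mono fun _ H x hx => hs (H x hx)
  inter_sets h h' := (h.and h').mono fun _ H x hx => ⟨H.1 x hx, H.2 x hx⟩

variable {P : Ideal (GenRing k m n)}

/-- The filter is taken on pairs (α, ℘) but generated by conditions on α alone; this makes the
exceptional variety independent of ℘. -/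
theorem eventually_specFilter_iff
    {Q : ∀ (α : Fin m → K) (p : Ideal (SpecRing k n α)) [p.IsPrime], Prop} :
    (∀ᶠ x : SpecPoint K P in specFilter K P, Q x.α x.p) ↔ Generically K P Q := by
  constructor
  · exact fun h => AlmostAll.mono h fun α H p hp h' => H ⟨α, p, hp, h'⟩ rfl
  · refine fun h => AlmostAll.mono h fun α H x hx => ?_
    subst hx
    exact H x.p x.isSpecPrime

theorem generically_specializes (K : Type v) [Field K] [Algebra k K] [P.IsPrime]
    (a : Localization.AtPrime P) : Generically K P fun α p _ => Specializes P α p a :=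
  (generically_matSpecializes K (Matrix.of fun (_ _ : Unit) => a)).mono fun _ _ _ h => h () ()

/-- The specialization maps `S → S_α`. -/
noncomputable def specFamily (K : Type v) [Field K] [Algebra k K] (P : Ideal (GenRing k m n))
    [P.IsPrime] :
    SpecFamily (Localization.AtPrime P) (specFilter K P) SpecPoint.Ring where
  toFun x := specElem P x.α x.p
  map_zero _ := specElem_zero
  map_one _ := specElem_one
  map_add a b := eventually_specFilter_iff.2 <|
    ((generically_specializes K a).and (generically_specializes K b)).mono fun _ _ _ h =>
      (h.1.isSpecOf.add h.2.isSpecOf).specElem_eq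
  map_mul a b := eventually_specFilter_iff.2 <|
    ((generically_specializes K a).and (generically_specializes K b)).mono fun _ _ _ h =>
      (h.1.isSpecOf.mul h.2.isSpecOf).specElem_eq
  exact _ _ h := eventually_specFilter_iff.2 (generically_exact K h)

theorem pdLE_atPrime [P.IsPrime] (A : Type u) [AddCommGroup A]
    [Module (Localization.AtPrime P) A] : PdLE (Localization.AtPrime P) A n :=
  pdLE_localization P.primeCompl (fun B _ _ => pdLE_mvPolynomial _ n B) A

theorem FinFreePres.generically_specializes [P.IsPrime] (K : Type v) [Field K] [Algebra k K]
    {M : Type u} [AddCommGroup M] [Module (Localization.AtPrime P) M]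
    (F : FinFreePres (Localization.AtPrime P) M) :
    Generically K P fun α p _ => F.Specializes α p :=
  generically_matSpecializes K F.mat

/-- The modules presented by the specializations of two presentations of the same module are
isomorphic. -/
theorem FinFreePres.generically_equiv [P.IsPrime] (K : Type v) [Field K] [Algebra k K]
    {M : Type u} [AddCommGroup M] [Module (Localization.AtPrime P) M]
    (F G : FinFreePres (Localization.AtPrime P) M) :
    Generically K P fun α p _ =>
      Nonempty (F.SpecModule α p ≃ₗ[Localization.AtPrime p] G.SpecModule α p) :=
  eventually_specFilter_iff.1 ((specFamily K P).eventually_mod_equiv F G)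

theorem exists_generically_ext_tor [P.IsPrime] (K : Type v) [Field K] [Algebra k K]
    {L M : Type u} [AddCommGroup L] [Module (Localization.AtPrime P) L]
    [Module.Finite (Localization.AtPrime P) L]
    [AddCommGroup M] [Module (Localization.AtPrime P) M]
    [Module.Finite (Localization.AtPrime P) M]
    (FL : FinFreePres (Localization.AtPrime P) L)
    (FM : FinFreePres (Localization.AtPrime P) M) :
    ∃ (FE : ∀ i : ℕ, FinFreePres (Localization.AtPrime P)
        (ExtModule (Localization.AtPrime P) L M i))
      (FT : ∀ i : ℕ, FinFreePres (Localization.AtPrime P)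
        (TorModule (Localization.AtPrime P) L M i)),
      Generically K P fun α p _ => ∀ i : ℕ, (FE i).Specializes α p ∧ (FT i).Specializes α p ∧
        Nonempty (ExtModule (Localization.AtPrime p)
          (FL.SpecModule α p) (FM.SpecModule α p) i ≃ₗ[Localization.AtPrime p]
            (FE i).SpecModule α p) ∧
        Nonempty (TorModule (Localization.AtPrime p)
          (FL.SpecModule α p) (FM.SpecModule α p) i ≃ₗ[Localization.AtPrime p]
            (FT i).SpecModule α p) := by
  obtain ⟨FE, FT, ⟨N, hN⟩, h⟩ := (specFamily K P).exists_ext_tor FM FL pdLE_atPrime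
  have hiso : Generically K P fun α p _ => ∀ i : ℕ,
      Nonempty (ExtModule (Localization.AtPrime p)
        (FL.SpecModule α p) (FM.SpecModule α p) i ≃ₗ[Localization.AtPrime p]
          (FE i).SpecModule α p) ∧
      Nonempty (TorModule (Localization.AtPrime p)
        (FL.SpecModule α p) (FM.SpecModule α p) i ≃ₗ[Localization.AtPrime p]
          (FT i).SpecModule α p) := eventually_specFilter_iff.1 h
  refine ⟨FE, FT, ((Generically.forall_finite fun i : Fin N =>
    ((FE i).generically_specializes K).and ((FT i).generically_specializes K)).and
      hiso).mono fun α p _ H i => ?_⟩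
  -- For i ≥ N the presentation matrices have no rows, so there is nothing to specialize; the
  -- remaining degrees are finite in number.
  have hs : (FE i).Specializes α p ∧ (FT i).Specializes α p := by
    by_cases hi : N ≤ i
    · have hE : IsEmpty (Fin (FE i).r₀) := (hN i hi).1 ▸ Fin.isEmpty'
      have hT : IsEmpty (Fin (FT i).r₀) := (hN i hi).2 ▸ Fin.isEmpty'
      exact ⟨fun x => hE.elim x, fun x => hT.elim x⟩
    · exact H.1 ⟨i, not_le.1 hi⟩
  exact ⟨hs.1, hs.2, H.2 i⟩

end Localizations

end Specialization

theorem proposition3p3 {k : Type u} {K : Type v} [Field k] [Field K] [Algebra k K]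
    [Infinite K] {m n : ℕ} (P : Ideal (GenRing k m n)) [P.IsPrime]
    (L M : Type u) [AddCommGroup L] [Module (Localization.AtPrime P) L]
    [Module.Finite (Localization.AtPrime P) L]
    [AddCommGroup M] [Module (Localization.AtPrime P) M]
    [Module.Finite (Localization.AtPrime P) M]
    (FL : FinFreePres (Localization.AtPrime P) L)
    (FM : FinFreePres (Localization.AtPrime P) M) :
    -- for each `i` and all presentations of the two modules `Ext^i_S(L, M)`, `Tor_i^S(L, M)`
    (∀ (i : ℕ)
      (FE : FinFreePres (Localization.AtPrime P)
        (ExtModule (Localization.AtPrime P) L M i))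
      (FT : FinFreePres (Localization.AtPrime P)
        (TorModule (Localization.AtPrime P) L M i)),
      AlmostAll K m fun α =>
        ∀ (p : Ideal (SpecRing k n α)) [p.IsPrime],
          IsSpecPrime α P p →
          FL.Specializes α p ∧ FM.Specializes α p ∧ FE.Specializes α p ∧ FT.Specializes α p ∧
          Nonempty (ExtModule (Localization.AtPrime p)
            (FL.SpecModule α p) (FM.SpecModule α p) i ≃ₗ[Localization.AtPrime p]
              FE.SpecModule α p) ∧
          Nonempty (TorModule (Localization.AtPrime p)
            (FL.SpecModule α p) (FM.SpecModule α p) i ≃ₗ[Localization.AtPrime p]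
              FT.SpecModule α p)) ∧
    -- with suitable presentations, the exceptional set does not depend on `i` either
    (∃ (FE : ∀ i : ℕ, FinFreePres (Localization.AtPrime P)
        (ExtModule (Localization.AtPrime P) L M i))
      (FT : ∀ i : ℕ, FinFreePres (Localization.AtPrime P)
        (TorModule (Localization.AtPrime P) L M i)),
      AlmostAll K m fun α =>
        ∀ (p : Ideal (SpecRing k n α)) [p.IsPrime],
          IsSpecPrime α P p →
          FL.Specializes α p ∧ FM.Specializes α p ∧
          ∀ i : ℕ, (FE i).Specializes α p ∧ (FT i).Specializes α p ∧
            Nonempty (ExtModule (Localization.AtPrime p)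
              (FL.SpecModule α p) (FM.SpecModule α p) i ≃ₗ[Localization.AtPrime p]
                (FE i).SpecModule α p) ∧
            Nonempty (TorModule (Localization.AtPrime p)
              (FL.SpecModule α p) (FM.SpecModule α p) i ≃ₗ[Localization.AtPrime p]
                (FT i).SpecModule α p)) := by
  obtain ⟨FE', FT', h⟩ := exists_generically_ext_tor K FL FM
  have hLM := (FL.generically_specializes K).and (FM.generically_specializes K)
  refine ⟨fun i FE FT => ?_, FE', FT', ?_⟩
  -- Arbitrary presentations in a single degree are compared with the chosen ones, at the cost of a
  -- further exceptional set that depends on them.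
  · have H := (hLM.and ((FE.generically_specializes K).and (FT.generically_specializes K))).and
      (h.and (((FE' i).generically_equiv K FE).and ((FT' i).generically_equiv K FT)))
    refine AlmostAll.mono H fun α H p _ hp => ?_
    obtain ⟨⟨⟨hL, hM⟩, hE, hT⟩, h', ⟨e⟩, ⟨e'⟩⟩ := H p hp
    obtain ⟨-, -, ⟨f⟩, ⟨f'⟩⟩ := h' i
    exact ⟨hL, hM, hE, hT, ⟨f.trans e⟩, ⟨f'.trans e'⟩⟩
  · refine AlmostAll.mono (hLM.and h) fun α H p _ hp => ?_
    obtain ⟨⟨hL, hM⟩, h'⟩ := H p hp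
    exact ⟨hL, hM, h'⟩
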